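/- Let $R>0$, $p\in(2,\infty]$, and let $b\in L^p_{\rm loc}([0,\infty);\,r\,dr)$ be a real-valued non-negative function vanishing (almost everywhere) outside the interval $(0,R)$. Put $B(x)=b(|x|)$ for $x\in\mathbb{R}^2$, suppose that $\int_{\mathbb{R}^2}B\,dx>0$, and let $$\alpha=\frac1{2\pi}\int_{\mathbb{R}^2}B\,dx,\qquad \mu_\alpha=\min_{m\in\mathbb{Z}}|m-\alpha|,\qquad \lambda(R)=\int_0^R b(t)\,t\log t\,dt,$$ $$h(x)=-\frac1{2\pi}\int_{\mathbb{R}^2}B(y)\log|x-y|\,dy,\qquad A_h=(\partial_{x_2}h,\,-\partial_{x_1}h),\qquad Q_+[u]=\int_{\mathbb{R}^2}\big(|(i\nabla+A_h)u|^2+B|u|^2\big)\,dx .$$ Let $g_+(r)=1$ for $0\le r\le R$ and $g_+(r)=R^{-\alpha}r^{\alpha}$ for $r>R$, and set $$\beta_+(B;R)=\left(\frac{\inf_{x\in\mathbb{R}^2}e^{-h(x)}/g_+(|x|)}{\sup_{x\in\mathbb{R}^2}e^{-h(x)}/g_+(|x|)}\right)^2 .$$ Then $h$ is differentiable on $\mathbb{R}^2$,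 $$\beta_+(B;R)=\frac{e^{2\lambda(R)}}{R^{2\alpha}},$$ and for every complex-valued $u\in H^1(\mathbb{R}^2)$ the integral defining $Q_+[u]$ converges absolutely and $$Q_+[u]\ \ge\ \mu_\alpha^2\,\frac{e^{2\lambda(R)}}{R^{2\alpha}}\int_{\mathbb{R}^2}\frac{|u|^2}{R^2+|x|^2}\,dx .$$ -/

import Mathlib

open MeasureTheory
open scoped ENNReal ContDiff

noncomputable section

namespace PauliHardy

/-- The Euclidean plane `ℝ²`, with the Euclidean norm and Lebesgue measure. -/
abbrev Plane : Type := EuclideanSpace ℝ (Fin 2)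

/-- The partial derivative in the direction of the `j`-th coordinate of a real function. -/
def partialDeriv (j : Fin 2) (f : Plane → ℝ) (x : Plane) : ℝ :=
  fderiv ℝ f x (EuclideanSpace.single j (1 : ℝ))

/-- `g = (g 0, g 1)` is the weak (distributional) gradient of the function `u`. -/
def HasWeakGradient (u : Plane → ℂ) (g : Fin 2 → Plane → ℂ) : Prop :=
  ∀ (j : Fin 2) (φ : Plane → ℝ), ContDiff ℝ ∞ φ → HasCompactSupport φ →
    ∫ x, partialDeriv j φ x • u x = -∫ x, φ x • g j x

/-- `g` is a square integrable weak gradient of `u`. -/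
def HasL2WeakGradient (u : Plane → ℂ) (g : Fin 2 → Plane → ℂ) : Prop :=
  (∀ j, MemLp (g j) 2 volume) ∧ HasWeakGradient u g

/-- Membership in the Sobolev space `H¹(ℝ²)` of complex valued functions. -/
def MemH1 (u : Plane → ℂ) : Prop :=
  MemLp u 2 volume ∧ ∃ g, HasL2WeakGradient u g

open Classical in
/-- The weak gradient of a function in `H¹(ℝ²)` (unique up to null sets; zero by convention
for functions without a square integrable weak gradient). -/
def weakGradient (u : Plane → ℂ) : Fin 2 → Plane → ℂ :=
  if hu : ∃ g, HasL2WeakGradient u g then Classical.choose hu else 0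

/-- The normalized flux `α = (2π)⁻¹ ∫ B` of a magnetic field `B`. -/
def flux (B : Plane → ℝ) : ℝ := 1 / (2 * Real.pi) * ∫ x, B x

/-- The scalar potential `h(x) = -(2π)⁻¹ ∫ B(y) log |x - y| dy`. -/
def scalarPotential (B : Plane → ℝ) (x : Plane) : ℝ :=
  -(1 / (2 * Real.pi)) * ∫ y, B y * Real.log ‖x - y‖

/-- The vector potential `A_h = (∂₂ h, -∂₁ h)`. -/
def vectorPotential (B : Plane → ℝ) (x : Plane) : Plane :=
  !₂[partialDeriv 1 (scalarPotential B) x, -partialDeriv 0 (scalarPotential B) x]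

/-- The density `|(i∇ + A_h) u|² + B |u|²` of the quadratic form `Q₊`. -/
def pauliDensity (B : Plane → ℝ) (u : Plane → ℂ) (x : Plane) : ℝ :=
  (∑ j : Fin 2, ‖Complex.I * weakGradient u j x + (vectorPotential B x j : ℂ) * u x‖ ^ 2)
    + B x * ‖u x‖ ^ 2

/-- The quadratic form `Q₊[u] = ∫ (|(i∇ + A_h) u|² + B |u|²) dx`. -/
def pauliForm (B : Plane → ℝ) (u : Plane → ℂ) : ℝ := ∫ x, pauliDensity B u x

/-- The distance `μ_α` from `α` to the set of integers. -/
def distInt (α : ℝ) : ℝ := ⨅ m : ℤ, |(m : ℝ) - α|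

/-- The comparison function `g₊(ρ; r)`: it is `1` for `r ≤ ρ` and `ρ^(-α) r^α` for `r > ρ`. -/
def gPlus (α ρ r : ℝ) : ℝ := if r ≤ ρ then 1 else ρ ^ (-α) * r ^ α

/-- `k₊(ρ) = inf e^(-h(x)) / g₊(ρ; |x|)` over the plane. -/
def kPlus (B : Plane → ℝ) (ρ : ℝ) : ℝ :=
  ⨅ x : Plane, Real.exp (-scalarPotential B x) / gPlus (flux B) ρ ‖x‖

/-- `K₊(ρ) = sup e^(-h(x)) / g₊(ρ; |x|)` over the plane. -/
def capKPlus (B : Plane → ℝ) (ρ : ℝ) : ℝ :=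
  ⨆ x : Plane, Real.exp (-scalarPotential B x) / gPlus (flux B) ρ ‖x‖

/-- `β₊(B; ρ) = (k₊(ρ) / K₊(ρ))²`. -/
def betaPlus (B : Plane → ℝ) (ρ : ℝ) : ℝ := (kPlus B ρ / capKPlus B ρ) ^ 2

/-- `b ∈ L^p_loc(ℝ₊; r dr)`, where `ℝ₊ = [0, ∞)`: integrability up to the origin. -/
def MemLpLocRadial (b : ℝ → ℝ) (p : ℝ≥0∞) : Prop :=
  ∀ T : ℝ, 0 < T →
    MemLp b p ((volume.restrict (Set.Ioc 0 T)).withDensity (fun r => ENNReal.ofReal r))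

/-- The radial field `B(x) = b(|x|)`. -/
def radialField (b : ℝ → ℝ) (x : Plane) : ℝ := b ‖x‖

/-- `λ(R) = ∫₀ᴿ b(t) t log t dt`. -/
def logMoment (b : ℝ → ℝ) (R : ℝ) : ℝ := ∫ t in (0 : ℝ)..R, b t * t * Real.log t

end PauliHardy

end

/-! Since B is radial, so is h: averaging the logarithm over circles gives h(x) = f(|x|) with f' =
-Φ/r, where Φ(r) = ∫₀^r b t dt (`scalarPotential_radialField`, `hasDerivAt_radialPotential`). Hence
f decreases, f(0) = -λ(R), and f(r) = -α log r for r ≥ R. So e^{-h}/g₊ has minimum e^{λ(R)} and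
maximum R^α, which gives β₊ =: β, equal also to e^{2(f(R)-f(0))}. Square integrability of b with
respect to r dr gives Φ(r)/r → 0 at the origin, hence differentiability of h there, and Φ ≤ C r,
hence a bounded A_h.

For a test function in polar coordinates, U(r,θ), put N = ∫|U|² dθ and J = ∫ Im(Ū U_θ) dθ.
Integrating the field term by parts in r (b r = Φ') turns Q₊ into ∫ D dr, with D = r∫|U_r|² +
r⁻¹∫|-iU_θ - ΦU|² - 2Φ∫Re(Ū U_r). Since J' = 2∫Im(conj(U_r) U_θ), the Pauli factorisation reads D =
r∫|U_r - (i/r)U_θ - (Φ/r)U|² - J'.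

Write D = (1-w)D + wD, with w = e^{2(f(r)-f(0))} on [0,R] and w = β beyond, and use the
factorisation in the first summand. On the disc w' = -2wΦ/r, so integrating (1-w)J' by parts cancels
the ΦJ cross term of wD. What remains contains w r∫|U_r - (Φ/r)U|², and completing a square extracts
the Hardy weight at the cost of a boundary term βμ²N(R) (`le_integral_radialDensity_inner`).
Outside, Φ = α is constant: wD gives the Hardy weight through the Poincaré inequality ∫|-iU_θ - αU|²
≥ μ²N on the circle (`distInt_sq_mul_integral_le`), together with a boundary gain βαN(R)
(`le_integral_radialDensity_outer`). The J terms at R cancel because w is continuous, and μ² ≤ α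
settles the rest.

The passage to H¹ uses density of test functions (`exists_contDiff_tendsto`) and continuity of every
term in the H¹ norm. For the possibly unbounded B this is `exists_integral_field_le`, again a
consequence of Φ ≤ C r. -/

namespace PauliHardy

open Set Filter Topology Real

/-! ### Polar coordinates in the plane -/

/-- The unit vector at angle `θ`. -/
noncomputable def unitVec (θ : ℝ) : Plane := !₂[Real.cos θ, Real.sin θ]

@[simp] lemma unitVec_zero (θ : ℝ) : unitVec θ 0 = Real.cos θ := rfl

@[simp] lemma unitVec_one (θ : ℝ) : unitVec θ 1 = Real.sin θ := rfl

lemma norm_plane_sq (x : Plane) : ‖x‖ ^ 2 = x 0 ^ 2 + x 1 ^ 2 := by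
  rw [EuclideanSpace.norm_sq_eq]
  simp

@[simp] lemma norm_unitVec (θ : ℝ) : ‖unitVec θ‖ = 1 := by
  have h : ‖unitVec θ‖ ^ 2 = 1 := by
    rw [norm_plane_sq]
    simp
  nlinarith [norm_nonneg (unitVec θ)]

lemma contDiff_unitVec : ContDiff ℝ ∞ unitVec := by
  rw [contDiff_euclidean]
  intro i
  fin_cases i
  · exact Real.contDiff_cos
  · exact Real.contDiff_sin

lemma continuous_unitVec : Continuous unitVec := contDiff_unitVec.continuous

lemma continuous_polar : Continuous fun p : ℝ × ℝ => p.1 • unitVec p.2 :=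
  continuous_fst.smul (continuous_unitVec.comp continuous_snd)

/-- The linear isometry between the complex numbers and the plane. -/
noncomputable def complexEquivPlane : ℂ ≃ₗᵢ[ℝ] Plane := Complex.orthonormalBasisOneI.repr

lemma complexEquivPlane_apply (z : ℂ) : complexEquivPlane z = !₂[z.re, z.im] := by
  ext i
  simp only [complexEquivPlane]
  rw [Complex.orthonormalBasisOneI_repr_apply]

lemma complexEquivPlane_polarCoord_symm (p : ℝ × ℝ) :
    complexEquivPlane (Complex.polarCoord.symm p) = p.1 • unitVec p.2 := by
  rw [complexEquivPlane_apply, Complex.polarCoord_symm_apply]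
  ext i
  fin_cases i <;> simp [unitVec, -Complex.ofReal_cos, -Complex.ofReal_sin]

lemma measurePreserving_complexEquivPlane : MeasurePreserving complexEquivPlane :=
  Complex.orthonormalBasisOneI.measurePreserving_repr

/-- The product of Lebesgue measure on the half-line and on `(-π, π)`. -/
noncomputable def polarMeasure : Measure (ℝ × ℝ) :=
  (volume.restrict (Ioi 0)).prod (volume.restrict (Ioo (-π) π))

lemma polarMeasure_eq :
    polarMeasure = (volume : Measure (ℝ × ℝ)).restrict polarCoord.target := by
  rw [polarMeasure, Measure.prod_restrict]
  rfl

lemma integral_polar {F : Type*} [NormedAddCommGroup F] [NormedSpace ℝ F] (f : Plane → F) :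
    ∫ x, f x = ∫ p, p.1 • f (p.1 • unitVec p.2) ∂polarMeasure := by
  rw [← measurePreserving_complexEquivPlane.integral_comp
    complexEquivPlane.toHomeomorph.measurableEmbedding,
    ← Complex.integral_comp_polarCoord_symm, polarMeasure_eq]
  simp_rw [complexEquivPlane_polarCoord_symm]

lemma lintegral_polar (f : Plane → ℝ≥0∞) :
    ∫⁻ x, f x = ∫⁻ p, ENNReal.ofReal p.1 * f (p.1 • unitVec p.2) ∂polarMeasure := by
  rw [← measurePreserving_complexEquivPlane.lintegral_comp_emb
    complexEquivPlane.toHomeomorph.measurableEmbedding,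
    ← Complex.lintegral_comp_polarCoord_symm, polarMeasure_eq]
  simp_rw [complexEquivPlane_polarCoord_symm, smul_eq_mul]

lemma ae_polar_pos : ∀ᵐ p ∂polarMeasure, 0 < p.1 := by
  rw [polarMeasure_eq]
  filter_upwards [ae_restrict_mem polarCoord.open_target.measurableSet] with p hp
  exact hp.1

lemma integrable_polar_iff {F : Type*} [NormedAddCommGroup F] [NormedSpace ℝ F] {f : Plane → F}
    (hf : AEStronglyMeasurable f) (hf' : AEStronglyMeasurable
      (fun p : ℝ × ℝ => p.1 • f (p.1 • unitVec p.2)) polarMeasure) :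
    Integrable f ↔
      Integrable (fun p : ℝ × ℝ => p.1 • f (p.1 • unitVec p.2)) polarMeasure := by
  have key : ∫⁻ x, ‖f x‖ₑ = ∫⁻ p, ‖p.1 • f (p.1 • unitVec p.2)‖ₑ ∂polarMeasure := by
    rw [lintegral_polar]
    refine lintegral_congr_ae ?_
    filter_upwards [ae_polar_pos] with p hp
    rw [enorm_smul, Real.enorm_eq_ofReal hp.le]
  rw [Integrable, Integrable, and_iff_right hf, and_iff_right hf', hasFiniteIntegral_iff_enorm,
    hasFiniteIntegral_iff_enorm, key]

/-- A null set of radii corresponds to a null set in the plane. -/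
lemma ae_norm_of_ae_pos {P : ℝ → Prop} (h : ∀ᵐ r : ℝ, 0 < r → P r) : ∀ᵐ x : Plane, P ‖x‖ := by
  obtain ⟨t, hts, htm, ht0⟩ := exists_measurable_superset_of_null (ae_iff.1 h)
  have h1 : volume {x : Plane | ‖x‖ ∈ t} = 0 := by
    have hm : MeasurableSet {x : Plane | ‖x‖ ∈ t} := measurable_norm htm
    rw [← lintegral_indicator_one hm, lintegral_polar]
    rw [lintegral_eq_zero_iff']
    · have : ∀ᵐ p ∂polarMeasure, p.1 ∉ t := by
        have h2 : ∀ᵐ r ∂(volume.restrict (Ioi (0:ℝ))), r ∉ t :=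
          ae_restrict_of_ae (measure_eq_zero_iff_ae_notMem.1 ht0)
        exact Measure.quasiMeasurePreserving_fst.ae h2
      filter_upwards [this, ae_polar_pos] with p hp hp0
      have : p.1 • unitVec p.2 ∉ {x : Plane | ‖x‖ ∈ t} := by
        simp only [mem_ofPred_eq, norm_smul, norm_unitVec, mul_one, Real.norm_eq_abs,
          abs_of_pos hp0]
        exact hp
      simp [Set.indicator_of_notMem this]
    · refine Measurable.aemeasurable ?_
      refine (ENNReal.measurable_ofReal.comp measurable_fst).mul ?_
      exact (measurable_one.indicator hm).comp continuous_polar.measurable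
  -- The hypothesis says nothing at radius zero, so the origin is discarded as a null set.
  have h3 : ∀ᵐ x : Plane, x ≠ 0 := by
    simp [ae_iff]
  filter_upwards [measure_eq_zero_iff_ae_notMem.1 h1, h3] with x hx hx0
  by_contra hP
  exact hx (hts (by
    simp only [mem_ofPred_eq, not_forall]
    exact ⟨norm_pos_iff.2 hx0, hP⟩))

/-! ### Radial profiles: the flux function and the radial potential -/

/-- A Borel radial field profile, nonnegative, supported in `(0, R)` and square integrable with
respect to `r dr`. -/
structure IsRadialProfile (b : ℝ → ℝ) (R : ℝ) : Prop where
  pos : 0 < R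
  measurable : Measurable b
  nonneg : ∀ r, 0 ≤ b r
  eq_zero : ∀ r, r ∉ Ioo 0 R → b r = 0
  integrable_sq : Integrable fun r => b r ^ 2 * r

/-- The flux (divided by `2π`) through the disc of radius `r`. -/
noncomputable def radialFlux (b : ℝ → ℝ) (r : ℝ) : ℝ := ∫ t in (0:ℝ)..r, b t * t

/-- The profile of the scalar potential. -/
noncomputable def radialPotential (b : ℝ → ℝ) (r : ℝ) : ℝ := -∫ t, b t * t * Real.log (max r t)

/-- Provides a majorant of the logarithmic kernel that does not depend on `r`, for dominated
convergence down to `r = 0`. -/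
lemma abs_log_max_le {r t M : ℝ} (ht : 0 < t) (htM : t ≤ M) (hrM : r ≤ M) :
    |Real.log (max r t)| ≤ |Real.log t| + |Real.log M| := by
  have h1 : Real.log t ≤ Real.log (max r t) := Real.log_le_log ht (le_max_right _ _)
  have h2 : Real.log (max r t) ≤ Real.log M :=
    Real.log_le_log (lt_max_of_lt_right ht) (max_le hrM htM)
  rw [abs_le]
  constructor
  · linarith [neg_abs_le (Real.log t), abs_nonneg (Real.log M)]
  · linarith [le_abs_self (Real.log M), abs_nonneg (Real.log t)]

lemma abs_log_sub_log_le {m x y : ℝ} (hm : 0 < m) (hx : m ≤ x) (hy : m ≤ y) :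
    |Real.log x - Real.log y| ≤ m⁻¹ * |x - y| := by
  have key : ∀ x y : ℝ, m ≤ x → m ≤ y → Real.log x - Real.log y ≤ m⁻¹ * |x - y| := by
    intro x y hx hy
    have hx0 : 0 < x := hm.trans_le hx
    have hy0 : 0 < y := hm.trans_le hy
    rw [← Real.log_div hx0.ne' hy0.ne']
    calc Real.log (x / y) ≤ x / y - 1 := Real.log_le_sub_one_of_pos (by positivity)
      _ = y⁻¹ * (x - y) := by field_simp
      _ ≤ y⁻¹ * |x - y| := by gcongr; exact le_abs_self _
      _ ≤ m⁻¹ * |x - y| := by gcongr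
  rw [abs_le]
  have h1 := key x y hx hy
  have h2 := key y x hy hx
  rw [abs_sub_comm y x] at h2
  constructor <;> linarith

namespace IsRadialProfile

variable {b : ℝ → ℝ} {R : ℝ}

lemma mul_nonneg' (hb : IsRadialProfile b R) (t : ℝ) : 0 ≤ b t * t := by
  by_cases ht : t ∈ Ioo 0 R
  · exact mul_nonneg (hb.nonneg t) ht.1.le
  · simp [hb.eq_zero t ht]

lemma measurable_mul (hb : IsRadialProfile b R) : Measurable fun t => b t * t :=
  hb.measurable.mul measurable_id

/-- On the support, `b t ≤ b² t + R`, from `(b - 1)² t ≥ 0` and `t < R`. -/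
lemma integrable_mul (hb : IsRadialProfile b R) : Integrable fun t => b t * t := by
  have h1 : Integrable ((Ioo 0 R).indicator fun _ : ℝ => R) :=
    (integrable_indicator_iff measurableSet_Ioo).2 (integrableOn_const (by simp))
  refine (hb.integrable_sq.add h1).mono' hb.measurable_mul.aestronglyMeasurable
    (ae_of_all _ fun t => ?_)
  rw [Real.norm_eq_abs, abs_of_nonneg (hb.mul_nonneg' t)]
  by_cases ht : t ∈ Ioo 0 R
  · simp only [Pi.add_apply, indicator_of_mem ht]
    nlinarith [ht.1, ht.2, mul_nonneg (sq_nonneg (b t - 1)) ht.1.le, hb.mul_nonneg' t]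
  · simp [hb.eq_zero t ht, indicator_of_notMem ht]

/-- By the arithmetic-geometric mean inequality `b |log t| ≤ b² + log² t`. The remaining function `t
log² t` is written as the square of `2 √t log √t`, so that continuity of `x log x` at zero makes it
bounded on `[0, R]`. -/
lemma integrable_mul_log (hb : IsRadialProfile b R) :
    Integrable fun t => b t * t * |Real.log t| := by
  have h1 : Integrable ((Ioo 0 R).indicator fun t : ℝ => (2 * (√t * Real.log (√t))) ^ 2) := by
    refine (integrable_indicator_iff measurableSet_Ioo).2 ?_
    refine IntegrableOn.mono_set (t := Icc 0 R) ?_ Ioo_subset_Icc_self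
    refine Continuous.integrableOn_Icc ?_
    exact (continuous_const.mul (Real.continuous_mul_log.comp Real.continuous_sqrt)).pow 2
  refine (hb.integrable_sq.add h1).mono'
    (hb.measurable_mul.mul Real.measurable_log.norm).aestronglyMeasurable
    (ae_of_all _ fun t => ?_)
  rw [Real.norm_eq_abs, abs_of_nonneg (mul_nonneg (hb.mul_nonneg' t) (abs_nonneg _))]
  by_cases ht : t ∈ Ioo 0 R
  · simp only [Pi.add_apply, indicator_of_mem ht]
    rw [Real.log_sqrt ht.1.le]
    have h2 : (2 * (√t * (Real.log t / 2))) ^ 2 = t * |Real.log t| ^ 2 := by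
      rw [sq_abs]
      have := Real.sq_sqrt ht.1.le
      linear_combination (Real.log t) ^ 2 * this
    rw [h2]
    nlinarith [ht.1, mul_nonneg (sq_nonneg (b t - |Real.log t|)) ht.1.le,
      mul_nonneg (sq_nonneg (b t + |Real.log t|)) ht.1.le]
  · simp [hb.eq_zero t ht, indicator_of_notMem ht]

lemma norm_mul_log_max_le (hb : IsRadialProfile b R) {r M : ℝ} (hrM : r ≤ M) (hRM : R ≤ M)
    (t : ℝ) : ‖b t * t * Real.log (max r t)‖ ≤
      b t * t * |Real.log t| + b t * t * |Real.log M| := by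
  rw [norm_mul, Real.norm_eq_abs, Real.norm_eq_abs, abs_of_nonneg (hb.mul_nonneg' t), ← mul_add]
  by_cases ht : t ∈ Ioo 0 R
  · exact mul_le_mul_of_nonneg_left (abs_log_max_le ht.1 (ht.2.le.trans hRM) hrM)
      (hb.mul_nonneg' t)
  · simp [hb.eq_zero t ht]

lemma measurable_mul_log_max (hb : IsRadialProfile b R) (r : ℝ) :
    Measurable fun t => b t * t * Real.log (max r t) :=
  hb.measurable_mul.mul (Real.measurable_log.comp (measurable_const.max measurable_id))

lemma integrable_mul_log_max (hb : IsRadialProfile b R) (r : ℝ) :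
    Integrable fun t => b t * t * Real.log (max r t) :=
  (hb.integrable_mul_log.add (hb.integrable_mul.mul_const _)).mono'
    (hb.measurable_mul_log_max r).aestronglyMeasurable
    (ae_of_all _ (hb.norm_mul_log_max_le (le_max_left r R) (le_max_right r R)))

lemma radialFlux_eq_setIntegral (hb : IsRadialProfile b R) (r : ℝ) :
    radialFlux b r = ∫ t in Iic r, b t * t := by
  have h0 : ∀ s : ℝ, s ≤ 0 → ∫ t in Iic s, b t * t = 0 := by
    intro s hs
    rw [setIntegral_congr_fun (g := fun _ => 0) measurableSet_Iic]
    · simp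
    · intro t ht
      simp [hb.eq_zero t fun h => absurd (h.1.trans_le ht) (not_lt.2 hs)]
  rw [radialFlux, ← intervalIntegral.integral_Iic_sub_Iic hb.integrable_mul.integrableOn
    hb.integrable_mul.integrableOn, h0 0 le_rfl, sub_zero]

lemma radialFlux_of_nonpos (hb : IsRadialProfile b R) {r : ℝ} (hr : r ≤ 0) :
    radialFlux b r = 0 := by
  rw [hb.radialFlux_eq_setIntegral, setIntegral_congr_fun (g := fun _ => 0) measurableSet_Iic]
  · simp
  · intro t ht
    simp [hb.eq_zero t fun h => absurd (h.1.trans_le ht) (not_lt.2 hr)]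

lemma radialFlux_of_ge (hb : IsRadialProfile b R) {r : ℝ} (hr : R ≤ r) :
    radialFlux b r = ∫ t, b t * t := by
  rw [hb.radialFlux_eq_setIntegral]
  refine setIntegral_eq_integral_of_forall_compl_eq_zero fun t ht => ?_
  simp [hb.eq_zero t fun h => ht (h.2.le.trans hr)]

lemma radialFlux_nonneg (hb : IsRadialProfile b R) (r : ℝ) : 0 ≤ radialFlux b r := by
  rw [hb.radialFlux_eq_setIntegral]
  exact integral_nonneg fun t => hb.mul_nonneg' t

lemma continuous_radialFlux (hb : IsRadialProfile b R) : Continuous (radialFlux b) :=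
  intervalIntegral.continuous_primitive (fun _ _ => hb.integrable_mul.intervalIntegrable) 0

/-- Cauchy–Schwarz in the weighted form `b ≤ r/(2η) b² + η/(2r)`, integrated against `t dt` over
`(0, r)`. The free parameter `η` gives both boundedness (`η = 1`) and the limit at zero (`η` small).
-/
lemma radialFlux_div_le (hb : IsRadialProfile b R) {r η : ℝ} (hr : 0 < r) (hη : 0 < η) :
    radialFlux b r / r ≤ (∫ t in (0:ℝ)..r, b t ^ 2 * t) / (2 * η) + η / 4 := by
  have hc : IntervalIntegrable (fun t : ℝ => η / (2 * r) * t) volume 0 r :=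
    (continuous_const.mul continuous_id).intervalIntegrable _ _
  have h1 : radialFlux b r ≤ ∫ t in (0:ℝ)..r, (r / (2 * η) * (b t ^ 2 * t) + η / (2 * r) * t) := by
    refine intervalIntegral.integral_mono_on hr.le hb.integrable_mul.intervalIntegrable
      ((hb.integrable_sq.const_mul _).intervalIntegrable.add hc) fun t ht => ?_
    have h2 : r / (2 * η) * (b t ^ 2 * t) + η / (2 * r) * t - b t * t =
        t * (r * b t - η) ^ 2 / (2 * η * r) := by
      field_simp
      ring
    have h3 : 0 ≤ t * (r * b t - η) ^ 2 / (2 * η * r) := by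
      have := ht.1
      positivity
    linarith
  rw [intervalIntegral.integral_add (hb.integrable_sq.const_mul _).intervalIntegrable hc,
    intervalIntegral.integral_const_mul, intervalIntegral.integral_const_mul, integral_id] at h1
  rw [div_le_iff₀ hr]
  refine h1.trans (le_of_eq ?_)
  field_simp
  ring

lemma radialFlux_div_nonneg (hb : IsRadialProfile b R) (r : ℝ) : 0 ≤ radialFlux b r / r := by
  rcases le_or_gt r 0 with hr | hr
  · simp [hb.radialFlux_of_nonpos hr]
  · exact div_nonneg (hb.radialFlux_nonneg r) hr.le

lemma exists_radialFlux_div_le (hb : IsRadialProfile b R) :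
    ∃ C, 0 ≤ C ∧ ∀ r, radialFlux b r / r ≤ C := by
  have h : ∀ t, 0 ≤ b t ^ 2 * t := fun t => by
    rw [sq, mul_assoc]
    exact mul_nonneg (hb.nonneg t) (hb.mul_nonneg' t)
  refine ⟨(∫ t, b t ^ 2 * t) / (2 * 1) + 1 / 4,
    add_nonneg (div_nonneg (integral_nonneg h) (by norm_num)) (by norm_num), fun r => ?_⟩
  rcases le_or_gt r 0 with hr | hr
  · rw [hb.radialFlux_of_nonpos hr, zero_div]
    exact add_nonneg (div_nonneg (integral_nonneg h) (by norm_num)) (by norm_num)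
  · refine (hb.radialFlux_div_le hr one_pos).trans ?_
    gcongr
    rw [intervalIntegral.integral_of_le hr.le]
    exact setIntegral_le_integral hb.integrable_sq (ae_of_all _ h)

/-- At the origin the convention of division by zero supplies the value `0`, which is the right
limit: with `η = ε` the integral of `b² t` over `(0, r)` tends to `0`, and only `ε / 4` remains. -/
lemma continuous_radialFlux_div (hb : IsRadialProfile b R) :
    Continuous fun r => radialFlux b r / r := by
  rw [continuous_iff_continuousAt]
  intro r
  rcases eq_or_ne r 0 with rfl | hr
  · rw [ContinuousAt, div_zero, Metric.tendsto_nhds]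
    intro ε hε
    have h1 : Tendsto (fun r : ℝ => (∫ t in (0:ℝ)..r, b t ^ 2 * t) / (2 * ε) + ε / 4) (𝓝 0)
        (𝓝 ((∫ t in (0:ℝ)..0, b t ^ 2 * t) / (2 * ε) + ε / 4)) :=
      (((intervalIntegral.continuous_primitive
        (fun _ _ => hb.integrable_sq.intervalIntegrable) 0).div_const _).add_const _).tendsto 0
    have h2 : (∫ t in (0:ℝ)..0, b t ^ 2 * t) / (2 * ε) + ε / 4 < ε := by
      simp
      linarith
    filter_upwards [h1.eventually_lt_const h2] with r hr
    rw [Real.dist_eq, sub_zero, abs_of_nonneg (hb.radialFlux_div_nonneg r)]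
    rcases le_or_gt r 0 with hr0 | hr0
    · simpa [hb.radialFlux_of_nonpos hr0] using hε
    · exact (hb.radialFlux_div_le hr0 hε).trans_lt hr
  · exact hb.continuous_radialFlux.continuousAt.div continuousAt_id hr

/-- For `t ≠ r` the map `s ↦ log (max s t)` has derivative `1/r` at `r` when `t < r` and `0` when `t
> r`, and it is Lipschitz for `s > r/2` uniformly in `t`. Differentiation under the integral
therefore leaves only the flux through the disc of radius `r`. -/
lemma hasDerivAt_radialPotential_of_pos (hb : IsRadialProfile b R) {r : ℝ} (hr : 0 < r) :
    HasDerivAt (radialPotential b) (-(radialFlux b r / r)) r := by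
  have key := hasDerivAt_integral_of_dominated_loc_of_lip (μ := volume) (𝕜 := ℝ) (x₀ := r)
    (F := fun r t => b t * t * Real.log (max r t)) (s := Ioi (r / 2))
    (F' := fun t => (Iic r).indicator (fun t => b t * t) t / r)
    (bound := fun t => b t * t * (r / 2)⁻¹)
    (Ioi_mem_nhds (by linarith))
    (Eventually.of_forall fun s => (hb.measurable_mul_log_max s).aestronglyMeasurable)
    (hb.integrable_mul_log_max r)
    ((hb.measurable_mul.indicator measurableSet_Iic).div_const r).aestronglyMeasurable
    (ae_of_all _ fun t => ?_) (hb.integrable_mul.mul_const _) ?_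
  · have h2 := key.2.neg
    rw [integral_div, integral_indicator measurableSet_Iic, ← hb.radialFlux_eq_setIntegral] at h2
    exact h2
  · refine LipschitzOnWith.of_dist_le_mul fun x hx y hy => ?_
    rw [Real.dist_eq, Real.dist_eq, ← mul_sub, abs_mul, Real.coe_nnabs,
      abs_mul (b t * t) (r / 2)⁻¹, mul_assoc]
    refine mul_le_mul_of_nonneg_left ?_ (abs_nonneg _)
    rw [abs_of_pos (by positivity : 0 < (r / 2)⁻¹)]
    refine (abs_log_sub_log_le (m := r / 2) (by positivity) (le_max_of_le_left (le_of_lt hx))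
      (le_max_of_le_left (le_of_lt hy))).trans ?_
    exact mul_le_mul_of_nonneg_left (abs_max_sub_max_le_abs x y t) (by positivity)
  · filter_upwards [Measure.ae_ne volume r] with t ht
    rcases lt_or_gt_of_ne ht with h | h
    · have : HasDerivAt (fun x => b t * t * Real.log x) (b t * t * r⁻¹) r :=
        (Real.hasDerivAt_log hr.ne').const_mul _
      rw [indicator_of_mem (by exact h.le), div_eq_mul_inv]
      refine this.congr_of_eventuallyEq ?_
      filter_upwards [Ioi_mem_nhds h] with x hx
      rw [max_eq_left (le_of_lt hx)]
    · rw [indicator_of_notMem (by simpa using h), zero_div]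
      refine (hasDerivAt_const r (b t * t * Real.log t)).congr_of_eventuallyEq ?_
      filter_upwards [Iio_mem_nhds h] with x hx
      rw [max_eq_right (le_of_lt hx)]

lemma radialPotential_of_nonpos (hb : IsRadialProfile b R) {r : ℝ} (hr : r ≤ 0) :
    radialPotential b r = radialPotential b 0 := by
  rw [radialPotential, radialPotential]
  congr 1
  refine integral_congr_ae (ae_of_all _ fun t => ?_)
  by_cases ht : t ∈ Ioo 0 R
  · simp only
    rw [max_eq_right (hr.trans ht.1.le), max_eq_right ht.1.le]
  · simp [hb.eq_zero t ht]

/-- At `r = 0` the potential is continuous and its derivative elsewhere has a limit, so the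
derivative exists there and equals that limit. The function is constant on the negative axis, which
makes the two-sided statement meaningful. -/
lemma hasDerivAt_radialPotential (hb : IsRadialProfile b R) (r : ℝ) :
    HasDerivAt (radialPotential b) (-(radialFlux b r / r)) r := by
  refine hasDerivAt_of_hasDerivAt_of_ne' (x := 0) (g := fun r => -(radialFlux b r / r)) ?_ ?_
    hb.continuous_radialFlux_div.neg.continuousAt r
  · intro y hy
    rcases lt_or_gt_of_ne hy with h | h
    · rw [hb.radialFlux_of_nonpos h.le, zero_div, neg_zero]
      refine (hasDerivAt_const y (radialPotential b 0)).congr_of_eventuallyEq ?_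
      filter_upwards [Iio_mem_nhds h] with x hx
      exact hb.radialPotential_of_nonpos (le_of_lt hx)
    · exact hb.hasDerivAt_radialPotential_of_pos h
  · refine ContinuousAt.neg ?_
    refine continuousAt_of_dominated
      (bound := fun t => b t * t * |Real.log t| + b t * t * |Real.log (max 1 R)|)
      (Eventually.of_forall fun s => (hb.measurable_mul_log_max s).aestronglyMeasurable)
      ?_ (hb.integrable_mul_log.add (hb.integrable_mul.mul_const _)) (ae_of_all _ fun t => ?_)
    · filter_upwards [Iio_mem_nhds (zero_lt_one (α := ℝ))] with r hr
      exact ae_of_all _ (hb.norm_mul_log_max_le (le_max_of_le_left (le_of_lt hr))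
        (le_max_right 1 R))
    · by_cases ht : t ∈ Ioo 0 R
      · refine continuousAt_const.mul (ContinuousAt.log ?_ (lt_max_of_lt_right ht.1).ne')
        exact (continuous_id.max continuous_const).continuousAt
      · simp only [hb.eq_zero t ht, zero_mul]
        exact continuousAt_const

lemma antitone_radialPotential (hb : IsRadialProfile b R) : Antitone (radialPotential b) :=
  antitone_of_hasDerivAt_nonpos hb.hasDerivAt_radialPotential
    fun r => by
      simpa using hb.radialFlux_div_nonneg r

lemma radialPotential_zero (hb : IsRadialProfile b R) :
    radialPotential b 0 = -logMoment b R := by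
  rw [radialPotential, logMoment, intervalIntegral.integral_of_le hb.pos.le,
    setIntegral_eq_integral_of_forall_compl_eq_zero]
  · congr 1
    refine integral_congr_ae (ae_of_all _ fun t => ?_)
    by_cases ht : t ∈ Ioo 0 R
    · simp only
      rw [max_eq_right ht.1.le]
    · simp [hb.eq_zero t ht]
  · intro t ht
    simp [hb.eq_zero t fun h => ht ⟨h.1, h.2.le⟩]

lemma radialPotential_of_ge (hb : IsRadialProfile b R) {r : ℝ} (hr : R ≤ r) :
    radialPotential b r = -((∫ t, b t * t) * Real.log r) := by
  rw [radialPotential, ← integral_mul_const]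
  congr 1
  refine integral_congr_ae (ae_of_all _ fun t => ?_)
  by_cases ht : t ∈ Ioo 0 R
  · simp only
    rw [max_eq_left (ht.2.le.trans hr)]
  · simp [hb.eq_zero t ht]

end IsRadialProfile

/-! ### Circle means of the logarithm, and the potential and flux of a radial field -/

lemma unitVec_periodic : Function.Periodic unitVec (2 * π) := by
  intro θ
  simp [unitVec]

lemma norm_sub_smul_unitVec (x : Plane) (r θ : ℝ) :
    ‖x - r • unitVec θ‖ = ‖circleMap 0 r θ - complexEquivPlane.symm x‖ := by
  rw [← complexEquivPlane.norm_map (circleMap 0 r θ - _), map_sub,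
    LinearIsometryEquiv.apply_symm_apply, norm_sub_rev]
  congr 2
  rw [complexEquivPlane_apply]
  ext i
  fin_cases i <;> simp [unitVec, circleMap]

lemma periodic_log_norm_sub (x : Plane) (r : ℝ) :
    Function.Periodic (fun θ => Real.log ‖x - r • unitVec θ‖) (2 * π) := by
  intro θ
  simp only [unitVec_periodic θ]

lemma intervalIntegrable_log_norm_sub (x : Plane) (r : ℝ) (c d : ℝ) :
    IntervalIntegrable (fun θ => Real.log ‖x - r • unitVec θ‖) volume c d := by
  refine (periodic_log_norm_sub x r).intervalIntegrable (t := 0) (by positivity) ?_ _ _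
  have := circleIntegrable_log_norm_sub_const (a := complexEquivPlane.symm x) (c := 0) r
  rw [zero_add]
  simp_rw [norm_sub_smul_unitVec]
  exact this

/-- The mean of the logarithmic potential over a circle. -/
lemma integral_log_norm_sub_smul_unitVec (x : Plane) {r : ℝ} (hr : 0 < r) :
    ∫ θ in Ioo (-π) π, Real.log ‖x - r • unitVec θ‖ = 2 * π * Real.log (max r ‖x‖) := by
  have h1 := circleAverage_log_norm_sub_const_eq_log_radius_add_posLog
    (a := complexEquivPlane.symm x) (c := 0) hr.ne'
  have h2 := (periodic_log_norm_sub x r).intervalIntegral_add_eq 0 (-π)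
  rw [Real.circleAverage, zero_sub, norm_neg, LinearIsometryEquiv.norm_map, smul_eq_mul] at h1
  simp_rw [← norm_sub_smul_unitVec] at h1
  rw [zero_add, show -π + 2 * π = π by ring] at h2
  rw [← integral_Ioc_eq_integral_Ioo, ← intervalIntegral.integral_of_le (by linarith [pi_pos]),
    ← h2]
  have h3 : Real.log r + Real.posLog (r⁻¹ * ‖x‖) = Real.log (max r ‖x‖) := by
    rw [Real.posLog_eq_log_max_one (by positivity), ← Real.log_mul hr.ne' (by positivity),
      mul_max_of_nonneg _ _ hr.le, mul_one, mul_inv_cancel_left₀ hr.ne']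
  rw [← h3, ← h1]
  field_simp

/-- If `s ≤ P` and `P ≥ 0`, then `|s| ≤ 2P - s`. Applied with `P` a positive part of a logarithm
that bounds the integrand above, this reduces the absolute integral to the mean, which is known
exactly. -/
lemma integral_abs_log_norm_sub_smul_unitVec_le (x : Plane) {r : ℝ} (hr : 0 < r) :
    ∫ θ in Ioo (-π) π, |Real.log ‖x - r • unitVec θ‖| ≤
      2 * π * (2 * Real.posLog (r + ‖x‖) - Real.log (max r ‖x‖)) := by
  have hint : IntegrableOn (fun θ => Real.log ‖x - r • unitVec θ‖) (Ioo (-π) π) := by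
    have := (intervalIntegrable_log_norm_sub x r (-π) π).1
    exact this.mono_set Ioo_subset_Ioc_self
  have h1 : ∀ θ, |Real.log ‖x - r • unitVec θ‖| ≤
      2 * Real.posLog (r + ‖x‖) - Real.log ‖x - r • unitVec θ‖ := by
    intro θ
    have h2 : ‖x - r • unitVec θ‖ ≤ r + ‖x‖ := by
      refine (norm_sub_le _ _).trans ?_
      rw [norm_smul, norm_unitVec, Real.norm_of_nonneg hr.le]
      linarith
    have h3 := Real.posLog_le_posLog (norm_nonneg _) h2
    have h4 : Real.log ‖x - r • unitVec θ‖ ≤ Real.posLog ‖x - r • unitVec θ‖ :=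
      le_max_right _ _
    have h5 : 0 ≤ Real.posLog (r + ‖x‖) := Real.posLog_nonneg
    rw [abs_le]
    constructor <;> linarith
  calc ∫ θ in Ioo (-π) π, |Real.log ‖x - r • unitVec θ‖|
      ≤ ∫ θ in Ioo (-π) π, (2 * Real.posLog (r + ‖x‖) - Real.log ‖x - r • unitVec θ‖) :=
        integral_mono hint.abs ((integrable_const _).sub hint) h1
    _ = _ := by
        rw [integral_sub (integrable_const _) hint, integral_log_norm_sub_smul_unitVec x hr]
        simp
        rw [max_eq_left (by linarith [pi_pos])]
        ring

namespace IsRadialProfile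

variable {b : ℝ → ℝ} {R : ℝ}

lemma measurable_radialField (hb : IsRadialProfile b R) : Measurable (radialField b) :=
  hb.measurable.comp measurable_norm

/-- The absolute integrability that Fubini requires: the bound on each circle leaves a majorant in
the radius made of `b t` and `b t |log t|`. -/
lemma integrable_mul_log_polar (hb : IsRadialProfile b R) (x : Plane) :
    Integrable (fun p : ℝ × ℝ => b p.1 * p.1 * Real.log ‖x - p.1 • unitVec p.2‖)
      polarMeasure := by
  have hm : Measurable fun p : ℝ × ℝ => b p.1 * p.1 * Real.log ‖x - p.1 • unitVec p.2‖ :=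
    (hb.measurable_mul.comp measurable_fst).mul
      (continuous_const.sub continuous_polar).norm.measurable.log
  rw [polarMeasure, integrable_prod_iff hm.aestronglyMeasurable]
  constructor
  · refine ae_of_all _ fun r => ?_
    exact Integrable.const_mul
      ((intervalIntegrable_log_norm_sub x r (-π) π).1.mono_set Ioo_subset_Ioc_self) (b r * r)
  · refine Integrable.mono' (g := fun t => 2 * π * (b t * t * (2 * Real.posLog (R + ‖x‖)) +
      (b t * t * |Real.log t| + b t * t * |Real.log (max ‖x‖ R)|))) ?_ ?_ ?_
    · exact (((hb.integrable_mul.mul_const _).add (hb.integrable_mul_log.add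
        (hb.integrable_mul.mul_const _))).const_mul _).integrableOn
    · exact (hm.aestronglyMeasurable.norm).integral_prod_right'
    · filter_upwards [ae_restrict_mem measurableSet_Ioi] with r hr
      have h0 : 0 ≤ b r * r := hb.mul_nonneg' r
      rw [Real.norm_of_nonneg (integral_nonneg fun _ => norm_nonneg _)]
      simp_rw [norm_mul (b r * r), Real.norm_of_nonneg h0]
      rw [integral_const_mul]
      refine (mul_le_mul_of_nonneg_left
        (integral_abs_log_norm_sub_smul_unitVec_le x hr) h0).trans ?_
      have h1 := hb.norm_mul_log_max_le (le_max_left ‖x‖ R) (le_max_right ‖x‖ R) r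
      rw [max_comm ‖x‖ r] at h1
      have h2 := (neg_le_abs _).trans h1
      rw [mul_left_comm]
      refine mul_le_mul_of_nonneg_left ?_ (by positivity)
      rw [mul_sub]
      by_cases hrR : r ∈ Ioo 0 R
      · have h3 : Real.posLog (r + ‖x‖) ≤ Real.posLog (R + ‖x‖) :=
          Real.posLog_le_posLog (add_nonneg hrR.1.le (norm_nonneg _)) (by linarith [hrR.2])
        have h4 := mul_le_mul_of_nonneg_left h3 h0
        linarith
      · simp [hb.eq_zero r hrR]

/-- Newton's theorem: after Fubini in polar coordinates, the mean of `log |x - y|` over the circle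
`|y| = t` is `log (max |x| t)`. -/
lemma scalarPotential_radialField (hb : IsRadialProfile b R) (x : Plane) :
    scalarPotential (radialField b) x = radialPotential b ‖x‖ := by
  have h1 : ∫ y, radialField b y * Real.log ‖x - y‖ =
      ∫ p, b p.1 * p.1 * Real.log ‖x - p.1 • unitVec p.2‖ ∂polarMeasure := by
    rw [integral_polar]
    refine integral_congr_ae ?_
    filter_upwards [ae_polar_pos] with p hp
    simp only [radialField, norm_smul, norm_unitVec, mul_one, Real.norm_of_nonneg hp.le,
      smul_eq_mul]
    ring
  have h2 : ∫ y, radialField b y * Real.log ‖x - y‖ =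
      2 * π * ∫ t, b t * t * Real.log (max ‖x‖ t) := by
    have h3 := hb.integrable_mul_log_polar x
    rw [polarMeasure] at h3
    have h4 : ∫ t in Ioi (0 : ℝ), 2 * π * (b t * t * Real.log (max ‖x‖ t)) =
        ∫ t, 2 * π * (b t * t * Real.log (max ‖x‖ t)) := by
      refine setIntegral_eq_integral_of_forall_compl_eq_zero fun t ht => ?_
      simp [hb.eq_zero t fun h => ht h.1]
    rw [h1, polarMeasure, integral_prod _ h3, ← integral_const_mul, ← h4]
    refine setIntegral_congr_fun measurableSet_Ioi fun t ht => ?_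
    simp only
    rw [integral_const_mul, integral_log_norm_sub_smul_unitVec x ht, max_comm t]
    ring
  rw [scalarPotential, radialPotential, h2]
  field_simp

lemma integrable_radialField (hb : IsRadialProfile b R) : Integrable (radialField b) := by
  rw [integrable_polar_iff hb.measurable_radialField.aestronglyMeasurable]
  · have h : Integrable (fun p : ℝ × ℝ => b p.1 * p.1) polarMeasure := by
      rw [polarMeasure]
      exact (hb.integrable_mul.integrableOn (s := Ioi 0)).comp_fst _
    refine h.congr ?_
    filter_upwards [ae_polar_pos] with p hp
    simp only [radialField, norm_smul, norm_unitVec, mul_one, Real.norm_of_nonneg hp.le,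
      smul_eq_mul]
    ring
  · exact (measurable_fst.smul
      (hb.measurable_radialField.comp continuous_polar.measurable)).aestronglyMeasurable

lemma flux_radialField (hb : IsRadialProfile b R) :
    flux (radialField b) = ∫ t, b t * t := by
  have h1 : ∫ y, radialField b y = ∫ p, b p.1 * p.1 ∂polarMeasure := by
    rw [integral_polar]
    refine integral_congr_ae ?_
    filter_upwards [ae_polar_pos] with p hp
    simp only [radialField, norm_smul, norm_unitVec, mul_one, Real.norm_of_nonneg hp.le,
      smul_eq_mul]
    ring
  have h2 : Integrable (fun p : ℝ × ℝ => b p.1 * p.1)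
      ((volume.restrict (Ioi 0)).prod (volume.restrict (Ioo (-π) π))) :=
    (hb.integrable_mul.integrableOn (s := Ioi 0)).comp_fst _
  rw [flux, h1, polarMeasure, integral_prod _ h2]
  simp only [integral_const, smul_eq_mul]
  rw [integral_const_mul, setIntegral_eq_integral_of_forall_compl_eq_zero (s := Ioi (0 : ℝ))]
  · simp
    rw [max_eq_left (by linarith [pi_pos])]
    field_simp
    ring
  · intro t ht
    simp [hb.eq_zero t fun h => ht h.1]

end IsRadialProfile

/-! ### Gradient of the potential, the bounded vector potential, and the value of β₊ -/

namespace IsRadialProfile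

variable {b : ℝ → ℝ} {R : ℝ}

/-- The norm is not differentiable at the origin, but the radial potential has derivative zero
there, so its increment is `o(‖x‖)` and the formula, which reads `0` at `x = 0`, stays correct. -/
lemma hasFDerivAt_scalarPotential (hb : IsRadialProfile b R) (x : Plane) :
    HasFDerivAt (scalarPotential (radialField b))
      ((-(radialFlux b ‖x‖ / ‖x‖ ^ 2)) • innerSL ℝ x) x := by
  have h0 : scalarPotential (radialField b) = fun x => radialPotential b ‖x‖ :=
    funext hb.scalarPotential_radialField
  rw [h0]
  rcases eq_or_ne x 0 with rfl | hx
  · have h1 := hb.hasDerivAt_radialPotential 0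
    rw [div_zero, neg_zero, hasDerivAt_iff_isLittleO_nhds_zero] at h1
    simp only [zero_add, smul_zero, sub_zero] at h1
    rw [hasFDerivAt_iff_isLittleO_nhds_zero]
    simp only [map_zero, smul_zero, zero_add, zero_apply, sub_zero, norm_zero]
    have h2 : Tendsto (fun x : Plane => ‖x‖) (𝓝 0) (𝓝 0) := by
      simpa using (continuous_norm (E := Plane)).tendsto 0
    exact (h1.comp_tendsto h2).of_norm_right
  · have hx' : ‖x‖ ≠ 0 := norm_ne_zero_iff.2 hx
    have h1 : HasFDerivAt (fun x : Plane => ‖x‖) ((1 / ‖x‖) • innerSL ℝ x) x := by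
      have h2 := (hasStrictFDerivAt_norm_sq x).hasFDerivAt.sqrt (by positivity)
      simp only [Real.sqrt_sq (norm_nonneg _)] at h2
      refine h2.congr_fderiv ?_
      ext y
      simp
      field_simp
    refine ((hb.hasDerivAt_radialPotential ‖x‖).comp_hasFDerivAt x h1).congr_fderiv ?_
    ext y
    simp
    field_simp

lemma differentiable_scalarPotential (hb : IsRadialProfile b R) :
    Differentiable ℝ (scalarPotential (radialField b)) :=
  fun x => (hb.hasFDerivAt_scalarPotential x).differentiableAt

lemma partialDeriv_scalarPotential (hb : IsRadialProfile b R) (j : Fin 2) (x : Plane) :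
    partialDeriv j (scalarPotential (radialField b)) x =
      -(radialFlux b ‖x‖ / ‖x‖ ^ 2 * x j) := by
  rw [partialDeriv, (hb.hasFDerivAt_scalarPotential x).fderiv]
  simp [EuclideanSpace.inner_single_right]

lemma vectorPotential_zero (hb : IsRadialProfile b R) (x : Plane) :
    vectorPotential (radialField b) x 0 = -(radialFlux b ‖x‖ / ‖x‖ ^ 2 * x 1) := by
  simp [vectorPotential, hb.partialDeriv_scalarPotential]

lemma vectorPotential_one (hb : IsRadialProfile b R) (x : Plane) :
    vectorPotential (radialField b) x 1 = radialFlux b ‖x‖ / ‖x‖ ^ 2 * x 0 := by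
  simp [vectorPotential, hb.partialDeriv_scalarPotential]

lemma measurable_vectorPotential (hb : IsRadialProfile b R) (j : Fin 2) :
    Measurable fun x => vectorPotential (radialField b) x j := by
  have h : Measurable fun x : Plane => radialFlux b ‖x‖ / ‖x‖ ^ 2 :=
    (hb.continuous_radialFlux.measurable.comp measurable_norm).div (measurable_norm.pow_const 2)
  fin_cases j
  · simp only [Fin.zero_eta, hb.vectorPotential_zero]
    exact (h.mul (by fun_prop)).neg
  · simp only [Fin.mk_one, hb.vectorPotential_one]
    exact h.mul (by fun_prop)

/-- The modulus of `A_h` is at most `Φ(r)/r`, which is bounded. Hence the kinetic term is controlled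
by the H¹ norm. -/
lemma exists_abs_vectorPotential_le (hb : IsRadialProfile b R) :
    ∃ C, 0 ≤ C ∧ ∀ x j, |vectorPotential (radialField b) x j| ≤ C := by
  obtain ⟨C, hC0, hC⟩ := hb.exists_radialFlux_div_le
  have key : ∀ (x : Plane) (j : Fin 2), |radialFlux b ‖x‖ / ‖x‖ ^ 2 * x j| ≤ C := by
    intro x j
    have h1 : |x j| ≤ ‖x‖ := PiLp.norm_apply_le x j
    rw [abs_mul, abs_of_nonneg (div_nonneg (hb.radialFlux_nonneg _) (by positivity))]
    rcases eq_or_ne x 0 with rfl | hx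
    · simpa using hC0
    · have hx' : 0 < ‖x‖ := norm_pos_iff.2 hx
      calc radialFlux b ‖x‖ / ‖x‖ ^ 2 * |x j| ≤ radialFlux b ‖x‖ / ‖x‖ ^ 2 * ‖x‖ :=
            mul_le_mul_of_nonneg_left h1
              (div_nonneg (hb.radialFlux_nonneg _) (by positivity))
        _ = radialFlux b ‖x‖ / ‖x‖ := by field_simp
        _ ≤ C := hC _
  refine ⟨C, hC0, fun x j => ?_⟩
  fin_cases j
  · simp only [Fin.zero_eta, hb.vectorPotential_zero, abs_neg]
    exact key x 1
  · simp only [Fin.mk_one, hb.vectorPotential_one]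
    exact key x 0

/-- Inside the disc the quotient is `e^{-f}`, which increases from its value `e^{λ(R)}` at the
origin to `R^α` on the boundary. Outside, `e^{-f} = r^α` and the quotient is the constant `R^α`. -/
lemma exp_neg_scalarPotential_div_gPlus_mem (hb : IsRadialProfile b R) (x : Plane) :
    Real.exp (-scalarPotential (radialField b) x) / gPlus (flux (radialField b)) R ‖x‖ ∈
      Icc (Real.exp (logMoment b R)) (R ^ flux (radialField b)) := by
  have hR := hb.pos
  have h0 : Real.exp (-radialPotential b 0) = Real.exp (logMoment b R) := by
    rw [hb.radialPotential_zero, neg_neg]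
  have h1 : ∀ r, R ≤ r → Real.exp (-radialPotential b r) = r ^ flux (radialField b) := by
    intro r hr
    rw [hb.radialPotential_of_ge hr, neg_neg, ← hb.flux_radialField,
      Real.rpow_def_of_pos (hR.trans_le hr), mul_comm]
  have h2 : Real.exp (logMoment b R) ≤ R ^ flux (radialField b) := by
    rw [← h0, ← h1 R le_rfl]
    exact Real.exp_le_exp.2 (neg_le_neg (hb.antitone_radialPotential hR.le))
  rw [hb.scalarPotential_radialField, gPlus]
  split_ifs with h
  · rw [div_one, ← h0, ← h1 R le_rfl]
    exact ⟨Real.exp_le_exp.2 (neg_le_neg (hb.antitone_radialPotential (norm_nonneg x))),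
      Real.exp_le_exp.2 (neg_le_neg (hb.antitone_radialPotential h))⟩
  · rw [not_le] at h
    have hx : 0 < ‖x‖ := hR.trans h
    rw [h1 _ h.le, Real.rpow_neg hR.le]
    have h3 : ‖x‖ ^ flux (radialField b) / ((R ^ flux (radialField b))⁻¹ *
        ‖x‖ ^ flux (radialField b)) = R ^ flux (radialField b) := by
      have := (Real.rpow_pos_of_pos hx (flux (radialField b))).ne'
      field_simp
    rw [h3]
    exact ⟨h2, le_rfl⟩

lemma kPlus_radialField (hb : IsRadialProfile b R) :
    kPlus (radialField b) R = Real.exp (logMoment b R) := by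
  have h : IsLeast (range fun x : Plane => Real.exp (-scalarPotential (radialField b) x) /
      gPlus (flux (radialField b)) R ‖x‖) (Real.exp (logMoment b R)) := by
    refine ⟨⟨0, ?_⟩, ?_⟩
    · simp [hb.scalarPotential_radialField, hb.radialPotential_zero, gPlus, hb.pos.le]
    · rintro _ ⟨x, rfl⟩
      exact (hb.exp_neg_scalarPotential_div_gPlus_mem x).1
  exact h.csInf_eq

lemma capKPlus_radialField (hb : IsRadialProfile b R) :
    capKPlus (radialField b) R = R ^ flux (radialField b) := by
  have h : IsGreatest (range fun x : Plane => Real.exp (-scalarPotential (radialField b) x) /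
      gPlus (flux (radialField b)) R ‖x‖) (R ^ flux (radialField b)) := by
    refine ⟨⟨R • unitVec 0, ?_⟩, ?_⟩
    · simp [hb.scalarPotential_radialField, norm_smul, abs_of_pos hb.pos, gPlus,
        hb.radialPotential_of_ge le_rfl, hb.flux_radialField, Real.rpow_def_of_pos hb.pos,
        mul_comm (Real.log R)]
    · rintro _ ⟨x, rfl⟩
      exact (hb.exp_neg_scalarPotential_div_gPlus_mem x).2
  exact h.csSup_eq

lemma betaPlus_radialField (hb : IsRadialProfile b R) :
    betaPlus (radialField b) R =
      Real.exp (2 * logMoment b R) / R ^ (2 * flux (radialField b)) := by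
  rw [betaPlus, hb.kPlus_radialField, hb.capKPlus_radialField, div_pow, ← Real.exp_nat_mul,
    ← Real.rpow_mul_natCast hb.pos.le]
  push_cast
  rw [mul_comm 2 (flux _)]

end IsRadialProfile

/-! ### Distance to the integers and a Poincaré inequality on the circle -/

lemma distInt_nonneg (α : ℝ) : 0 ≤ distInt α := Real.iInf_nonneg fun _ => abs_nonneg _

lemma distInt_le (α : ℝ) (m : ℤ) : distInt α ≤ |(m : ℝ) - α| :=
  ciInf_le ⟨0, by rintro _ ⟨n, rfl⟩; exact abs_nonneg _⟩ m

lemma distInt_sq_le (α : ℝ) (m : ℤ) : distInt α ^ 2 ≤ ((m : ℝ) - α) ^ 2 := by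
  rw [← sq_abs ((m : ℝ) - α)]
  exact pow_le_pow_left₀ (distInt_nonneg α) (distInt_le α m) 2

lemma distInt_le_half (α : ℝ) : distInt α ≤ 1 / 2 :=
  (distInt_le α (round α)).trans (by rw [abs_sub_comm]; exact abs_sub_round α)

lemma neg_pi_lt_pi : -π < π := by linarith [pi_pos]

/-- The Fourier coefficients of the derivative of a `2π`-periodic function. -/
lemma fourierCoeffOn_deriv {f f' : ℝ → ℂ} (hf : ∀ θ, HasDerivAt f (f' θ) θ)
    (hf' : Continuous f') (hper : f π = f (-π)) (n : ℤ) :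
    fourierCoeffOn neg_pi_lt_pi f' n =
      Complex.I * n * fourierCoeffOn neg_pi_lt_pi f n := by
  rcases eq_or_ne n 0 with rfl | hn
  · have h1 : ∫ θ in (-π)..π, f' θ = f π - f (-π) :=
      intervalIntegral.integral_eq_sub_of_hasDerivAt (fun θ _ => hf θ)
        (hf'.intervalIntegrable _ _)
    rw [fourierCoeffOn_eq_integral]
    simp [h1, hper]
  · rw [fourierCoeffOn_of_hasDerivAt neg_pi_lt_pi hn (fun θ _ => hf θ)
      (hf'.intervalIntegrable _ _), hper]
    have h2 : (π : ℂ) ≠ 0 := by exact_mod_cast pi_ne_zero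
    have h3 : (n : ℂ) ≠ 0 := by exact_mod_cast hn
    have h4 := Complex.I_sq
    push_cast
    field_simp
    ring

/-- The operator `-i d/dθ - α` is diagonal in the exponentials, with eigenvalues `n - α`; its lowest
modulus is the distance from `α` to the integers. -/
lemma fourierCoeffOn_twisted {f f' : ℝ → ℂ} (hf : ∀ θ, HasDerivAt f (f' θ) θ)
    (hf' : Continuous f') (hper : f π = f (-π)) (α : ℝ) (n : ℤ) :
    fourierCoeffOn neg_pi_lt_pi (fun θ => -Complex.I * f' θ - α * f θ) n =
      (n - α) * fourierCoeffOn neg_pi_lt_pi f n := by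
  have hc : Continuous f := continuous_iff_continuousAt.2 fun θ => (hf θ).continuousAt
  have h1 := fourierCoeffOn_deriv hf hf' hper n
  have h2 : fourierCoeffOn neg_pi_lt_pi (fun θ => -Complex.I * f' θ - α * f θ) n =
      -Complex.I * fourierCoeffOn neg_pi_lt_pi f' n - α * fourierCoeffOn neg_pi_lt_pi f n := by
    simp only [fourierCoeffOn_eq_integral, smul_eq_mul, Complex.real_smul]
    have h3 : ∀ g : ℝ → ℂ, Continuous g → IntervalIntegrable
        (fun θ : ℝ => (fourier (-n) (θ : AddCircle (π - -π)) : ℂ) * g θ) volume (-π) π := by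
      intro g hg
      refine Continuous.intervalIntegrable ?_ _ _
      exact ((fourier (-n)).continuous.comp (AddCircle.continuous_mk' _)).mul hg
    rw [mul_left_comm, mul_left_comm (α : ℂ), ← mul_sub,
      ← intervalIntegral.integral_const_mul (-Complex.I),
      ← intervalIntegral.integral_const_mul (α : ℂ), ← intervalIntegral.integral_sub
        ((h3 f' hf').const_mul _) ((h3 f hc).const_mul _)]
    congr 1
    refine intervalIntegral.integral_congr fun θ _ => ?_
    ring
  rw [h2, h1]
  linear_combination (-n * fourierCoeffOn neg_pi_lt_pi f n) * Complex.I_sq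

/-- The Poincaré inequality on the circle for the operator `-i d/dθ - α`. -/
lemma distInt_sq_mul_integral_le {f f' : ℝ → ℂ} (hf : ∀ θ, HasDerivAt f (f' θ) θ)
    (hf' : Continuous f') (hper : f π = f (-π)) (α : ℝ) :
    distInt α ^ 2 * ∫ θ in (-π)..π, ‖f θ‖ ^ 2 ≤
      ∫ θ in (-π)..π, ‖-Complex.I * f' θ - α * f θ‖ ^ 2 := by
  have hc : Continuous f := continuous_iff_continuousAt.2 fun θ => (hf θ).continuousAt
  have hL : ∀ g : ℝ → ℂ, Continuous g → MemLp g 2 (volume.restrict (Ioc (-π) π)) := by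
    intro g hg
    refine (memLp_two_iff_integrable_sq_norm hg.aestronglyMeasurable).2 ?_
    exact ((hg.norm.pow 2).integrableOn_Icc).mono_set Ioc_subset_Icc_self
  have h1 := (hasSum_sq_fourierCoeffOn neg_pi_lt_pi (hL f hc)).mul_left (distInt α ^ 2)
  have h2 := hasSum_sq_fourierCoeffOn neg_pi_lt_pi
    (hL (fun θ => -Complex.I * f' θ - α * f θ) (by fun_prop))
  -- Parseval on both sides reduces the inequality to `distInt α ^ 2 ≤ (n - α) ^ 2` for each mode.
  have h3 := hasSum_le (fun n => ?_) h1 h2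
  · rw [smul_eq_mul, smul_eq_mul, mul_left_comm] at h3
    exact le_of_mul_le_mul_left h3 (inv_pos.2 (by linarith [pi_pos]))
  · rw [fourierCoeffOn_twisted hf hf' hper, norm_mul, mul_pow]
    refine mul_le_mul_of_nonneg_right ?_ (sq_nonneg _)
    have : ((n : ℂ) - α) = ((n - α : ℝ) : ℂ) := by push_cast; rfl
    rw [this, Complex.norm_real, Real.norm_eq_abs, sq_abs]
    exact distInt_sq_le α n

/-! ### Circle integrals of functions in polar coordinates -/

/-- Differentiation under the integral sign, for a continuous derivative. -/
lemma hasDerivAt_integral_of_continuous {F F' : ℝ → ℝ → ℝ} {c d : ℝ}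
    (hF : ∀ r θ, HasDerivAt (fun s => F s θ) (F' r θ) r) (hFc : ∀ r, Continuous (F r))
    (hF' : Continuous (Function.uncurry F')) (r : ℝ) :
    HasDerivAt (fun s => ∫ θ in c..d, F s θ) (∫ θ in c..d, F' r θ) r := by
  obtain ⟨C, hC⟩ := (isCompact_Icc.prod isCompact_uIcc).exists_bound_of_continuousOn
    (s := Icc (r - 1) (r + 1) ×ˢ uIcc c d) hF'.continuousOn
  refine (intervalIntegral.hasDerivAt_integral_of_dominated_loc_of_deriv_le
    (F := F) (F' := F') (bound := fun _ => C) (s := Icc (r - 1) (r + 1))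
    (Icc_mem_nhds (by linarith) (by linarith))
    (Eventually.of_forall fun s => (hFc s).aestronglyMeasurable)
    ((hFc r).intervalIntegrable _ _) ?_ ?_ (by simp) ?_).2
  · exact (hF'.comp (Continuous.prodMk_right r)).aestronglyMeasurable
  · exact ae_of_all _ fun θ hθ s hs => hC (s, θ) ⟨hs, uIoc_subset_uIcc hθ⟩
  · exact ae_of_all _ fun θ _ s _ => hF s θ

/-- A function in polar coordinates, together with its radial, angular and mixed derivatives,
vanishing for `r ≥ M`. -/
structure IsPolarFunction (U Ur Ut Urt : ℝ → ℝ → ℂ) (M : ℝ) : Prop where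
  cont : Continuous (Function.uncurry U)
  cont_r : Continuous (Function.uncurry Ur)
  cont_t : Continuous (Function.uncurry Ut)
  cont_rt : Continuous (Function.uncurry Urt)
  deriv_r : ∀ r θ, HasDerivAt (fun s => U s θ) (Ur r θ) r
  deriv_t : ∀ r θ, HasDerivAt (fun s => U r s) (Ut r θ) θ
  deriv_tr : ∀ r θ, HasDerivAt (fun s => Ut s θ) (Urt r θ) r
  deriv_rt : ∀ r θ, HasDerivAt (fun s => Ur r s) (Urt r θ) θ
  per : ∀ r, U r π = U r (-π)
  per_r : ∀ r, Ur r π = Ur r (-π)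
  zero_t : ∀ θ, Ut 0 θ = 0
  vanish : ∀ r θ, M ≤ r → U r θ = 0
  vanish_r : ∀ r θ, M ≤ r → Ur r θ = 0
  vanish_t : ∀ r θ, M ≤ r → Ut r θ = 0

/-- The integral over a circle of the squared modulus. -/
noncomputable def circleSq (V : ℝ → ℝ → ℂ) (r : ℝ) : ℝ := ∫ θ in (-π)..π, ‖V r θ‖ ^ 2

/-- The integral over a circle of `Re (conj V W)`. -/
noncomputable def circleRe (V W : ℝ → ℝ → ℂ) (r : ℝ) : ℝ :=
  ∫ θ in (-π)..π, ((V r θ).re * (W r θ).re + (V r θ).im * (W r θ).im)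

/-- The integral over a circle of `Im (conj V W)`. -/
noncomputable def circleIm (V W : ℝ → ℝ → ℂ) (r : ℝ) : ℝ :=
  ∫ θ in (-π)..π, ((V r θ).re * (W r θ).im - (V r θ).im * (W r θ).re)

lemma sq_norm_eq (z : ℂ) : ‖z‖ ^ 2 = z.re ^ 2 + z.im ^ 2 := by
  rw [Complex.sq_norm, Complex.normSq_apply]
  ring

lemma circleSq_nonneg (V : ℝ → ℝ → ℂ) (r : ℝ) : 0 ≤ circleSq V r :=
  intervalIntegral.integral_nonneg (by linarith [pi_pos]) fun _ _ => by positivity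

lemma hasDerivAt_re {f : ℝ → ℂ} {f' : ℂ} {x : ℝ} (h : HasDerivAt f f' x) :
    HasDerivAt (fun s => (f s).re) f'.re x :=
  Complex.reCLM.hasFDerivAt.comp_hasDerivAt x h

lemma hasDerivAt_im {f : ℝ → ℂ} {f' : ℂ} {x : ℝ} (h : HasDerivAt f f' x) :
    HasDerivAt (fun s => (f s).im) f'.im x :=
  Complex.imCLM.hasFDerivAt.comp_hasDerivAt x h

namespace IsPolarFunction

variable {U Ur Ut Urt : ℝ → ℝ → ℂ} {M : ℝ}

lemma hasDerivAt_circleSq (h : IsPolarFunction U Ur Ut Urt M) (r : ℝ) :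
    HasDerivAt (circleSq U) (2 * circleRe U Ur r) r := by
  have hc := h.cont
  have hcr := h.cont_r
  rw [circleRe, ← intervalIntegral.integral_const_mul]
  have h1 : circleSq U = fun s => ∫ θ in (-π)..π, ((U s θ).re ^ 2 + (U s θ).im ^ 2) := by
    funext s
    simp only [circleSq, sq_norm_eq]
  rw [h1]
  refine hasDerivAt_integral_of_continuous
    (F := fun s θ => (U s θ).re ^ 2 + (U s θ).im ^ 2)
    (F' := fun r θ => 2 * ((U r θ).re * (Ur r θ).re + (U r θ).im * (Ur r θ).im))
    (fun r θ => ?_) (fun r => ?_) ?_ r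
  · refine (((hasDerivAt_re (h.deriv_r r θ)).pow 2).add
      ((hasDerivAt_im (h.deriv_r r θ)).pow 2)).congr_deriv ?_
    simp
    ring
  · have := hc.uncurry_left r
    fun_prop
  · simp only [Function.uncurry_def] at *
    fun_prop

/-- The difference of the two integrands is `∂_θ Im(Ū U_r)`, whose integral over a period vanishes.
-/
lemma circleIm_mixed (h : IsPolarFunction U Ur Ut Urt M) (r : ℝ) :
    circleIm U Urt r = circleIm Ur Ut r := by
  have hc := h.cont.uncurry_left r
  have hcr := h.cont_r.uncurry_left r
  have hct := h.cont_t.uncurry_left r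
  have hcrt := h.cont_rt.uncurry_left r
  have h1 : ∫ θ in (-π)..π, ((((U r θ).re * (Urt r θ).im - (U r θ).im * (Urt r θ).re)) -
      ((Ur r θ).re * (Ut r θ).im - (Ur r θ).im * (Ut r θ).re)) = 0 := by
    rw [intervalIntegral.integral_eq_sub_of_hasDerivAt
      (f := fun θ => (U r θ).re * (Ur r θ).im - (U r θ).im * (Ur r θ).re)]
    · simp only [h.per, h.per_r, sub_self]
    · intro θ _
      refine (((hasDerivAt_re (h.deriv_t r θ)).mul (hasDerivAt_im (h.deriv_rt r θ))).sub
        ((hasDerivAt_im (h.deriv_t r θ)).mul (hasDerivAt_re (h.deriv_rt r θ)))).congr_deriv ?_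
      ring
    · exact Continuous.intervalIntegrable (by fun_prop) _ _
  rw [intervalIntegral.integral_sub (Continuous.intervalIntegrable (by fun_prop) _ _)
    (Continuous.intervalIntegrable (by fun_prop) _ _)] at h1
  exact sub_eq_zero.1 h1

/-- The product rule yields two terms which agree after integration by `circleIm_mixed`. This makes
the radial-angular cross term of the factorised square an exact derivative in `r`. -/
lemma hasDerivAt_circleIm (h : IsPolarFunction U Ur Ut Urt M) (r : ℝ) :
    HasDerivAt (circleIm U Ut) (2 * circleIm Ur Ut r) r := by
  have hc := h.cont
  have hcr := h.cont_r
  have hct := h.cont_t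
  have hcrt := h.cont_rt
  have h1 : 2 * circleIm Ur Ut r = ∫ θ in (-π)..π,
      (((Ur r θ).re * (Ut r θ).im - (Ur r θ).im * (Ut r θ).re) +
      ((U r θ).re * (Urt r θ).im - (U r θ).im * (Urt r θ).re)) := by
    have hc := h.cont.uncurry_left r
    have hcr := h.cont_r.uncurry_left r
    have hct := h.cont_t.uncurry_left r
    have hcrt := h.cont_rt.uncurry_left r
    rw [intervalIntegral.integral_add (Continuous.intervalIntegrable (by fun_prop) _ _)
      (Continuous.intervalIntegrable (by fun_prop) _ _), two_mul]
    congr 1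
    exact (h.circleIm_mixed r).symm
  rw [h1]
  refine hasDerivAt_integral_of_continuous
    (F := fun s θ => (U s θ).re * (Ut s θ).im - (U s θ).im * (Ut s θ).re)
    (F' := fun r θ => ((Ur r θ).re * (Ut r θ).im - (Ur r θ).im * (Ut r θ).re) +
      ((U r θ).re * (Urt r θ).im - (U r θ).im * (Urt r θ).re))
    (fun r θ => ?_) (fun r => ?_) ?_ r
  · refine (((hasDerivAt_re (h.deriv_r r θ)).mul (hasDerivAt_im (h.deriv_tr r θ))).sub
      ((hasDerivAt_im (h.deriv_r r θ)).mul (hasDerivAt_re (h.deriv_tr r θ)))).congr_deriv ?_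
    ring
  · have := hc.uncurry_left r
    have := hct.uncurry_left r
    fun_prop
  · simp only [Function.uncurry_def] at *
    fun_prop

/-- All squares completed later are combinations of `U_r`, `-i U_θ` and `U` with coefficients
depending on `r` alone, so this one expansion serves for each of them. -/
lemma integral_sq_combination (h : IsPolarFunction U Ur Ut Urt M) (r c₁ c₂ c₃ : ℝ) :
    ∫ θ in (-π)..π, ‖c₁ * Ur r θ + c₂ * (-Complex.I * Ut r θ) + c₃ * U r θ‖ ^ 2 =
      c₁ ^ 2 * circleSq Ur r + c₂ ^ 2 * circleSq Ut r + c₃ ^ 2 * circleSq U r +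
        2 * c₁ * c₂ * circleIm Ur Ut r + 2 * c₁ * c₃ * circleRe U Ur r +
        2 * c₂ * c₃ * circleIm U Ut r := by
  have hc := h.cont.uncurry_left r
  have hcr := h.cont_r.uncurry_left r
  have hct := h.cont_t.uncurry_left r
  simp only [circleSq, circleIm, circleRe, ← intervalIntegral.integral_const_mul]
  rw [← intervalIntegral.integral_add, ← intervalIntegral.integral_add,
    ← intervalIntegral.integral_add, ← intervalIntegral.integral_add,
    ← intervalIntegral.integral_add]
  · refine intervalIntegral.integral_congr fun θ _ => ?_
    simp only [sq_norm_eq]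
    simp
    ring
  all_goals exact Continuous.intervalIntegrable (by fun_prop) _ _

lemma combination_nonneg (h : IsPolarFunction U Ur Ut Urt M) (r c₁ c₂ c₃ : ℝ) :
    0 ≤ c₁ ^ 2 * circleSq Ur r + c₂ ^ 2 * circleSq Ut r + c₃ ^ 2 * circleSq U r +
        2 * c₁ * c₂ * circleIm Ur Ut r + 2 * c₁ * c₃ * circleRe U Ur r +
        2 * c₂ * c₃ * circleIm U Ut r := by
  rw [← h.integral_sq_combination]
  exact intervalIntegral.integral_nonneg (by linarith [pi_pos]) fun _ _ => by positivity

lemma distInt_sq_mul_circleSq_le (h : IsPolarFunction U Ur Ut Urt M) (r α : ℝ) :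
    distInt α ^ 2 * circleSq U r ≤
      circleSq Ut r - 2 * α * circleIm U Ut r + α ^ 2 * circleSq U r := by
  have h1 := h.integral_sq_combination r 0 1 (-α)
  have h2 := distInt_sq_mul_integral_le (h.deriv_t r) (h.cont_t.uncurry_left r) (h.per r) α
  have h3 : ∀ θ, ((0 : ℝ) : ℂ) * Ur r θ + (1 : ℝ) * (-Complex.I * Ut r θ) + (-α : ℝ) * U r θ =
      -Complex.I * Ut r θ - α * U r θ := by
    intro θ
    push_cast
    ring
  simp only [h3] at h1
  refine h2.trans (h1.trans ?_).le
  ring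

end IsPolarFunction

/-! ### The radial Hardy inequality -/

/-- The density in `r` of the quadratic form, after integration by parts of the field. -/
noncomputable def radialDensity (b : ℝ → ℝ) (U Ur Ut : ℝ → ℝ → ℂ) (r : ℝ) : ℝ :=
  r * circleSq Ur r + (circleSq Ut r - 2 * radialFlux b r * circleIm U Ut r +
    radialFlux b r ^ 2 * circleSq U r) / r - 2 * radialFlux b r * circleRe U Ur r

namespace IsRadialProfile

variable {b : ℝ → ℝ} {R : ℝ} {U Ur Ut Urt : ℝ → ℝ → ℂ} {M : ℝ}

/-- The density minus the Hardy term dominates an exact derivative `G'` on `(0, R)`. The part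
weighted by `1 - w` uses the Pauli square; in the part weighted by `w`, the ratio `w'/w = -2Φ/r`
removes the `ΦJ` term, and a square with the extra summand `c r U` produces the Hardy weight. No
angular spectral gap is used here; the negative boundary term is paid for by the exterior. -/
lemma le_integral_radialDensity_inner (hb : IsRadialProfile b R)
    (h : IsPolarFunction U Ur Ut Urt M) {β μ : ℝ} (hμ : μ ^ 2 ≤ 1)
    (hβ : β = Real.exp (2 * (radialPotential b R - radialPotential b 0)))
    (hint : IntegrableOn (fun r => radialDensity b U Ur Ut r -
      β * μ ^ 2 * (circleSq U r * (r / (R ^ 2 + r ^ 2)))) (Icc 0 R)) :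
    -(1 - β) * circleIm U Ut R - β * μ ^ 2 * circleSq U R ≤
      ∫ r in (0:ℝ)..R, (radialDensity b U Ur Ut r -
        β * μ ^ 2 * (circleSq U r * (r / (R ^ 2 + r ^ 2)))) := by
  have hR := hb.pos
  set w : ℝ → ℝ := fun r => Real.exp (2 * (radialPotential b r - radialPotential b 0)) with hw
  have hw' : ∀ r, HasDerivAt w (w r * (2 * -(radialFlux b r / r))) r := fun r =>
    (((hb.hasDerivAt_radialPotential r).sub_const _).const_mul 2).exp
  -- This choice makes `c R² = μ²`, so the boundary cost at `R` is exactly `β μ² N(R)`, and keeps `c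
  -- r² ≤ 1` on the disc.
  set c : ℝ := μ ^ 2 / R ^ 2 with hc
  set G : ℝ → ℝ := fun r => -((1 - w r) * circleIm U Ut r) - c * r ^ 2 * (w r * circleSq U r)
    with hG
  have hG' : ∀ r, HasDerivAt G
      (-((-(w r * (2 * -(radialFlux b r / r)))) * circleIm U Ut r +
        (1 - w r) * (2 * circleIm Ur Ut r)) -
      (c * (2 * r) * (w r * circleSq U r) + c * r ^ 2 *
        ((w r * (2 * -(radialFlux b r / r))) * circleSq U r + w r * (2 * circleRe U Ur r)))) r := by
    intro r
    refine ((((hw' r).const_sub 1).mul (h.hasDerivAt_circleIm r)).neg.sub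
      ((((hasDerivAt_pow 2 r).const_mul c).mul
        ((hw' r).mul (h.hasDerivAt_circleSq r))))).congr_deriv ?_
    simp
  have h0 : G 0 = 0 := by
    simp [hG, circleIm, h.zero_t]
  have hGR : G R = -(1 - β) * circleIm U Ut R - β * μ ^ 2 * circleSq U R := by
    simp only [hG, hc]
    rw [show w R = β from hβ.symm]
    field_simp
  have key := intervalIntegral.sub_le_integral_of_hasDeriv_right_of_le (g := G) hR.le
    (fun r _ => (hG' r).continuousAt.continuousWithinAt)
    (fun r _ => (hG' r).hasDerivWithinAt) hint ?_
  · rwa [h0, sub_zero, hGR] at key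
  · intro r hr
    have hr0 : 0 < r := hr.1
    have hw0 : 0 < w r := Real.exp_pos _
    have hw1 : w r ≤ 1 := by
      refine Real.exp_le_one_iff.2 ?_
      linarith [hb.antitone_radialPotential hr0.le]
    have hwβ : β ≤ w r := by
      rw [hβ]
      refine Real.exp_le_exp.2 ?_
      linarith [hb.antitone_radialPotential hr.2.le]
    have hβ0 : 0 ≤ β := hβ ▸ (Real.exp_pos _).le
    have hN := circleSq_nonneg U r
    have hT := circleSq_nonneg Ut r
    set Φ := radialFlux b r
    have q1 := h.combination_nonneg r 1 (1 / r) (-Φ / r)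
    have q2 := h.combination_nonneg r 1 0 (-Φ / r + c * r)
    -- The Hardy weight is at most `c r w`, since `β ≤ w` and `R² ≤ R² + r²`; and `c r ≤ 2 c r - c²
    -- r³` because `c r² ≤ 1`. The last expression is what completing the square leaves over.
    have hF : β * μ ^ 2 * (circleSq U r * (r / (R ^ 2 + r ^ 2))) ≤
        w r * (2 * c * r - c ^ 2 * r ^ 3) * circleSq U r := by
      have e1 : β * μ ^ 2 * (circleSq U r * (r / (R ^ 2 + r ^ 2))) ≤
          w r * μ ^ 2 * (circleSq U r * (r / R ^ 2)) := by
        gcongr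
        linarith [sq_nonneg r]
      refine e1.trans ?_
      have e2 : w r * μ ^ 2 * (circleSq U r * (r / R ^ 2)) = w r * (c * r) * circleSq U r := by
        rw [hc]
        ring
      rw [e2]
      have hcr : c * r ^ 2 ≤ 1 := by
        have : c * r ^ 2 = μ ^ 2 * (r / R) ^ 2 := by
          rw [hc]
          ring
        rw [this]
        have h3 : (r / R) ^ 2 ≤ 1 := by
          have : r / R ≤ 1 := (div_le_one hR).2 hr.2.le
          exact pow_le_one₀ (by positivity) this
        exact mul_le_one₀ hμ (by positivity) h3
      have hc0 : 0 ≤ c := by positivity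
      have : c * r ≤ 2 * c * r - c ^ 2 * r ^ 3 := by
        have : 0 ≤ c * r * (1 - c * r ^ 2) := mul_nonneg (by positivity) (by linarith)
        linarith
      gcongr
    have hX : 0 ≤ (1 - w r) * (r * (1 ^ 2 * circleSq Ur r + (1 / r) ^ 2 * circleSq Ut r +
        (-Φ / r) ^ 2 * circleSq U r + 2 * 1 * (1 / r) * circleIm Ur Ut r +
        2 * 1 * (-Φ / r) * circleRe U Ur r + 2 * (1 / r) * (-Φ / r) * circleIm U Ut r)) :=
      mul_nonneg (by linarith) (mul_nonneg hr0.le q1)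
    have hW : 0 ≤ w r * (r * (1 ^ 2 * circleSq Ur r + 0 ^ 2 * circleSq Ut r +
        (-Φ / r + c * r) ^ 2 * circleSq U r + 2 * 1 * 0 * circleIm Ur Ut r +
        2 * 1 * (-Φ / r + c * r) * circleRe U Ur r +
        2 * 0 * (-Φ / r + c * r) * circleIm U Ut r)) :=
      mul_nonneg hw0.le (mul_nonneg hr0.le q2)
    have hTr : 0 ≤ w r * (circleSq Ut r / r) := by positivity
    -- The density minus `G'` is the sum of the Pauli square, the shifted radial square, the angular
    -- term and the Hardy surplus, the first three of which are nonnegative.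
    have id : radialDensity b U Ur Ut r -
        (-((-(w r * (2 * -(Φ / r)))) * circleIm U Ut r + (1 - w r) * (2 * circleIm Ur Ut r)) -
        (c * (2 * r) * (w r * circleSq U r) + c * r ^ 2 *
        ((w r * (2 * -(Φ / r))) * circleSq U r + w r * (2 * circleRe U Ur r)))) =
        (1 - w r) * (r * (1 ^ 2 * circleSq Ur r + (1 / r) ^ 2 * circleSq Ut r +
        (-Φ / r) ^ 2 * circleSq U r + 2 * 1 * (1 / r) * circleIm Ur Ut r +
        2 * 1 * (-Φ / r) * circleRe U Ur r + 2 * (1 / r) * (-Φ / r) * circleIm U Ut r)) +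
        w r * (r * (1 ^ 2 * circleSq Ur r + 0 ^ 2 * circleSq Ut r +
        (-Φ / r + c * r) ^ 2 * circleSq U r + 2 * 1 * 0 * circleIm Ur Ut r +
        2 * 1 * (-Φ / r + c * r) * circleRe U Ur r +
        2 * 0 * (-Φ / r + c * r) * circleIm U Ut r)) + w r * (circleSq Ut r / r) +
        w r * (2 * c * r - c ^ 2 * r ^ 3) * circleSq U r := by
      simp only [radialDensity]
      field_simp
      ring
    linarith

/-- Beyond `R` the flux is the constant `α` and the weight is frozen at `β`. The share `1 - β` uses
the Pauli square; in the share `β` the circle Poincaré inequality gives `μ² N / r`, and `-2α Re⟨U,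
U_r⟩ = -α N'` integrates to the gain `α N(R)`. -/
lemma le_integral_radialDensity_outer (hb : IsRadialProfile b R)
    (h : IsPolarFunction U Ur Ut Urt M) (hM : R ≤ M) {α β : ℝ} (hα : α = ∫ t, b t * t)
    (hβ0 : 0 ≤ β) (hβ1 : β ≤ 1)
    (hint : IntegrableOn (fun r => radialDensity b U Ur Ut r -
      β * distInt α ^ 2 * (circleSq U r * (r / (R ^ 2 + r ^ 2)))) (Icc R M)) :
    (1 - β) * circleIm U Ut R + β * α * circleSq U R ≤
      ∫ r in R..M, (radialDensity b U Ur Ut r -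
        β * distInt α ^ 2 * (circleSq U r * (r / (R ^ 2 + r ^ 2)))) := by
  have hR := hb.pos
  set G : ℝ → ℝ := fun r => -((1 - β) * circleIm U Ut r) - β * α * circleSq U r with hG
  have hG' : ∀ r, HasDerivAt G (-((1 - β) * (2 * circleIm Ur Ut r)) -
      β * α * (2 * circleRe U Ur r)) r := fun r =>
    ((h.hasDerivAt_circleIm r).const_mul (1 - β)).neg.sub
      ((h.hasDerivAt_circleSq r).const_mul (β * α))
  have hGM : G M = 0 := by
    simp [hG, circleIm, circleSq, h.vanish M _ le_rfl]
  have key := intervalIntegral.sub_le_integral_of_hasDeriv_right_of_le (g := G) hM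
    (fun r _ => (hG' r).continuousAt.continuousWithinAt)
    (fun r _ => (hG' r).hasDerivWithinAt) hint ?_
  · rw [hGM, zero_sub] at key
    refine le_trans (le_of_eq ?_) key
    simp only [hG]
    ring
  · intro r hr
    have hr0 : 0 < r := hR.trans hr.1
    have hΦ : radialFlux b r = α := by rw [hb.radialFlux_of_ge hr.1.le, hα]
    have q1 := h.combination_nonneg r 1 (1 / r) (-α / r)
    have q2 := h.distInt_sq_mul_circleSq_le r α
    have hX : 0 ≤ (1 - β) * (r * (1 ^ 2 * circleSq Ur r + (1 / r) ^ 2 * circleSq Ut r +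
        (-α / r) ^ 2 * circleSq U r + 2 * 1 * (1 / r) * circleIm Ur Ut r +
        2 * 1 * (-α / r) * circleRe U Ur r + 2 * (1 / r) * (-α / r) * circleIm U Ut r)) :=
      mul_nonneg (by linarith) (mul_nonneg hr0.le q1)
    have hF : β * distInt α ^ 2 * (circleSq U r * (r / (R ^ 2 + r ^ 2))) ≤
        β * ((circleSq Ut r - 2 * α * circleIm U Ut r + α ^ 2 * circleSq U r) / r) := by
      have h3 : r / (R ^ 2 + r ^ 2) ≤ 1 / r := by
        rw [div_le_div_iff₀ (by positivity) hr0]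
        nlinarith [sq_nonneg R]
      have hN := circleSq_nonneg U r
      calc β * distInt α ^ 2 * (circleSq U r * (r / (R ^ 2 + r ^ 2)))
          ≤ β * distInt α ^ 2 * (circleSq U r * (1 / r)) := by gcongr
        _ = β * ((distInt α ^ 2 * circleSq U r) / r) := by ring
        _ ≤ _ := by gcongr
    have hA : 0 ≤ β * (r * circleSq Ur r) :=
      mul_nonneg hβ0 (mul_nonneg hr0.le (circleSq_nonneg Ur r))
    have id : radialDensity b U Ur Ut r - (-((1 - β) * (2 * circleIm Ur Ut r)) -
        β * α * (2 * circleRe U Ur r)) =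
        (1 - β) * (r * (1 ^ 2 * circleSq Ur r + (1 / r) ^ 2 * circleSq Ut r +
        (-α / r) ^ 2 * circleSq U r + 2 * 1 * (1 / r) * circleIm Ur Ut r +
        2 * 1 * (-α / r) * circleRe U Ur r + 2 * (1 / r) * (-α / r) * circleIm U Ut r)) +
        β * (r * circleSq Ur r) +
        β * ((circleSq Ut r - 2 * α * circleIm U Ut r + α ^ 2 * circleSq U r) / r) := by
      simp only [radialDensity, hΦ]
      field_simp
      ring
    linarith

/-- The Hardy inequality after integration over circles. -/
lemma le_integral_radialDensity (hb : IsRadialProfile b R)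
    (h : IsPolarFunction U Ur Ut Urt M) (hM : R ≤ M) {α β : ℝ} (hα : α = ∫ t, b t * t)
    (hβ : β = Real.exp (2 * (radialPotential b R - radialPotential b 0)))
    (hint : IntegrableOn (radialDensity b U Ur Ut) (Icc 0 M)) :
    β * distInt α ^ 2 * ∫ r in (0:ℝ)..M, circleSq U r * (r / (R ^ 2 + r ^ 2)) ≤
      ∫ r in (0:ℝ)..M, radialDensity b U Ur Ut r := by
  have hR := hb.pos
  have hα0 : 0 ≤ α := hα ▸ integral_nonneg hb.mul_nonneg'
  have hβ0 : 0 ≤ β := hβ ▸ (Real.exp_pos _).le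
  have hβ1 : β ≤ 1 := by
    rw [hβ]
    refine Real.exp_le_one_iff.2 ?_
    linarith [hb.antitone_radialPotential hR.le]
  have hμα : distInt α ≤ α := by
    have := distInt_le α 0
    rwa [Int.cast_zero, zero_sub, abs_neg, abs_of_nonneg hα0] at this
  have hμ0 := distInt_nonneg α
  have hμ1 := distInt_le_half α
  have hN : Continuous fun r => circleSq U r * (r / (R ^ 2 + r ^ 2)) := by
    have h1 : Continuous (circleSq U) :=
      continuous_iff_continuousAt.2 fun r => (h.hasDerivAt_circleSq r).continuousAt
    refine h1.mul (continuous_id.div (by fun_prop) fun r => ?_)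
    positivity
  have hint' : IntegrableOn (fun r => radialDensity b U Ur Ut r -
      β * distInt α ^ 2 * (circleSq U r * (r / (R ^ 2 + r ^ 2)))) (Icc 0 M) :=
    hint.sub ((continuous_const.mul hN).integrableOn_Icc)
  have h1 := hb.le_integral_radialDensity_inner h (μ := distInt α) (by nlinarith) hβ
    (hint'.mono_set (Icc_subset_Icc_right hM))
  have h2 := hb.le_integral_radialDensity_outer h hM hα hβ0 hβ1
    (hint'.mono_set (Icc_subset_Icc_left hR.le))
  have hii : ∀ c d, c ∈ Icc 0 M → d ∈ Icc 0 M → IntervalIntegrable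
      (fun r => radialDensity b U Ur Ut r -
      β * distInt α ^ 2 * (circleSq U r * (r / (R ^ 2 + r ^ 2)))) volume c d := by
    intro c d hc hd
    exact (hint'.mono_set (ordConnected_Icc.uIcc_subset hc hd)).intervalIntegrable
  have hM0 : (0:ℝ) ≤ M := hR.le.trans hM
  have h3 := intervalIntegral.integral_add_adjacent_intervals
    (hii 0 R ⟨le_rfl, hM0⟩ ⟨hR.le, hM⟩) (hii R M ⟨hR.le, hM⟩ ⟨hM0, le_rfl⟩)
  have hintM : IntervalIntegrable (radialDensity b U Ur Ut) volume 0 M :=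
    (hint.mono_set (by rw [uIcc_of_le hM0])).intervalIntegrable
  have hNM : IntervalIntegrable (fun r => β * distInt α ^ 2 *
      (circleSq U r * (r / (R ^ 2 + r ^ 2)))) volume 0 M :=
    (continuous_const.mul hN).intervalIntegrable _ _
  rw [intervalIntegral.integral_sub hintM hNM,
    intervalIntegral.integral_const_mul] at h3
  -- Adding the two halves cancels the `J(R)` terms and leaves this one; `μ ≤ 1/2` and `μ ≤ α` give
  -- `μ² ≤ α`.
  have h4 : 0 ≤ β * (α - distInt α ^ 2) * circleSq U R :=
    mul_nonneg (mul_nonneg hβ0 (by nlinarith)) (circleSq_nonneg U R)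
  linarith

end IsRadialProfile

/-! ### Smooth functions and the kinetic density in polar coordinates -/

/-- The unit tangent vector of the circle at angle `θ`. -/
noncomputable def perpVec (θ : ℝ) : Plane := !₂[-Real.sin θ, Real.cos θ]

@[simp] lemma perpVec_zero (θ : ℝ) : perpVec θ 0 = -Real.sin θ := rfl

@[simp] lemma perpVec_one (θ : ℝ) : perpVec θ 1 = Real.cos θ := rfl

lemma contDiff_perpVec : ContDiff ℝ ∞ perpVec := by
  rw [contDiff_euclidean]
  intro i
  fin_cases i
  · exact Real.contDiff_sin.neg
  · exact Real.contDiff_cos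

lemma continuous_perpVec : Continuous perpVec := contDiff_perpVec.continuous

lemma plane_eq_add (x : Plane) : x = x 0 • EuclideanSpace.single 0 (1 : ℝ) +
    x 1 • EuclideanSpace.single 1 (1 : ℝ) := by
  ext i
  fin_cases i <;> simp

lemma hasDerivAt_unitVec (θ : ℝ) : HasDerivAt unitVec (perpVec θ) θ := by
  have h : unitVec = fun θ => Real.cos θ • EuclideanSpace.single 0 (1 : ℝ) +
      Real.sin θ • EuclideanSpace.single 1 (1 : ℝ) := by
    funext θ
    exact plane_eq_add (unitVec θ)
  rw [h, plane_eq_add (perpVec θ)]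
  exact ((Real.hasDerivAt_cos θ).smul_const _).add ((Real.hasDerivAt_sin θ).smul_const _)

/-- The partial derivatives of a complex valued function. -/
noncomputable def partialDerivC (u : Plane → ℂ) (j : Fin 2) (x : Plane) : ℂ :=
  fderiv ℝ u x (EuclideanSpace.single j (1 : ℝ))

lemma fderiv_apply_eq (u : Plane → ℂ) (x v : Plane) :
    fderiv ℝ u x v = v 0 * partialDerivC u 0 x + v 1 * partialDerivC u 1 x := by
  conv_lhs => rw [plane_eq_add v]
  simp [partialDerivC]

/-- The function `u` in polar coordinates. -/
noncomputable def polarFun (u : Plane → ℂ) (r θ : ℝ) : ℂ := u (r • unitVec θ)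

/-- The radial derivative of `u` in polar coordinates. -/
noncomputable def polarFunR (u : Plane → ℂ) (r θ : ℝ) : ℂ :=
  fderiv ℝ u (r • unitVec θ) (unitVec θ)

/-- The angular derivative of `u` in polar coordinates. -/
noncomputable def polarFunT (u : Plane → ℂ) (r θ : ℝ) : ℂ :=
  r * fderiv ℝ u (r • unitVec θ) (perpVec θ)

/-- The mixed derivative of `u` in polar coordinates. -/
noncomputable def polarFunRT (u : Plane → ℂ) (r θ : ℝ) : ℂ :=
  r * fderiv ℝ (fderiv ℝ u) (r • unitVec θ) (unitVec θ) (perpVec θ) +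
    fderiv ℝ u (r • unitVec θ) (perpVec θ)

lemma isPolarFunction_polarFun {u : Plane → ℂ} (hu : ContDiff ℝ ∞ u) {M : ℝ}
    (hs : ∀ x, M ≤ ‖x‖ → u x = 0) (hs' : ∀ x, M ≤ ‖x‖ → fderiv ℝ u x = 0) :
    IsPolarFunction (polarFun u) (polarFunR u) (polarFunT u) (polarFunRT u) M := by
  have hd : Differentiable ℝ u := hu.differentiable (by simp)
  have hu1 : ContDiff ℝ ∞ (fderiv ℝ u) := hu.fderiv_right (by simp)
  have hd1 : Differentiable ℝ (fderiv ℝ u) := hu1.differentiable (by simp)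
  have hc1 : Continuous (fderiv ℝ u) := hu1.continuous
  have hc2 : Continuous (fderiv ℝ (fderiv ℝ u)) := (hu1.fderiv_right (m := ∞) (by simp)).continuous
  have hpol := continuous_polar
  have hcu : Continuous fun p : ℝ × ℝ => unitVec p.2 := continuous_unitVec.comp continuous_snd
  have hcp : Continuous fun p : ℝ × ℝ => perpVec p.2 := continuous_perpVec.comp continuous_snd
  have hr : ∀ r θ : ℝ, HasDerivAt (fun s : ℝ => s • unitVec θ) (unitVec θ) r := fun r θ => by
    simpa using (hasDerivAt_id r).smul_const (unitVec θ)
  have ht : ∀ r θ : ℝ, HasDerivAt (fun s : ℝ => r • unitVec s) (r • perpVec θ) θ := fun r θ =>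
    (hasDerivAt_unitVec θ).const_smul r
  have hnorm : ∀ r θ : ℝ, M ≤ r → M ≤ ‖r • unitVec θ‖ := fun r θ h => by
    rw [norm_smul, norm_unitVec, mul_one]
    exact h.trans (le_abs_self r)
  refine ⟨hu.continuous.comp hpol, (hc1.comp hpol).clm_apply hcu,
    (Complex.continuous_ofReal.comp continuous_fst).mul ((hc1.comp hpol).clm_apply hcp), ?_,
    fun r θ => ?_, fun r θ => ?_, fun r θ => ?_, fun r θ => ?_, fun r => ?_, fun r => ?_,
    fun θ => ?_, fun r θ h => ?_, fun r θ h => ?_, fun r θ h => ?_⟩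
  · exact ((Complex.continuous_ofReal.comp continuous_fst).mul
      (((hc2.comp hpol).clm_apply hcu).clm_apply hcp)).add ((hc1.comp hpol).clm_apply hcp)
  · exact (hd _).hasFDerivAt.comp_hasDerivAt r (hr r θ)
  · refine ((hd _).hasFDerivAt.comp_hasDerivAt θ (ht r θ)).congr_deriv ?_
    simp [polarFunT]
  · have h1 := ((hd1 _).hasFDerivAt.comp_hasDerivAt r (hr r θ)).clm_apply
      (hasDerivAt_const r (perpVec θ))
    refine ((Complex.ofRealCLM.hasFDerivAt.comp_hasDerivAt r (hasDerivAt_id r)).mul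
      h1).congr_deriv ?_
    simp [polarFunRT]
    ring
  · have h1 := ((hd1 _).hasFDerivAt.comp_hasDerivAt θ (ht r θ)).clm_apply (hasDerivAt_unitVec θ)
    refine h1.congr_deriv ?_
    -- The same mixed derivative must serve both orders of differentiation, which is the symmetry of
    -- the second derivative.
    have hsymm : IsSymmSndFDerivAt ℝ u (r • unitVec θ) :=
      hu.contDiffAt.isSymmSndFDerivAt (by
        rw [minSmoothness_of_isRCLikeNormedField]
        exact WithTop.coe_le_coe.2 le_top)
    simp [polarFunRT, hsymm.eq (unitVec θ) (perpVec θ)]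
  · simp [polarFun, unitVec]
  · simp [polarFunR, unitVec]
  · simp [polarFunT]
  · exact hs _ (hnorm r θ h)
  · simp [polarFunR, hs' _ (hnorm r θ h)]
  · simp [polarFunT, hs' _ (hnorm r θ h)]

/-- The kinetic density `|(i∇ + A_h) u|²` with `g` in place of the gradient. -/
noncomputable def kineticDensity (B : Plane → ℝ) (u : Plane → ℂ) (g : Fin 2 → Plane → ℂ)
    (x : Plane) : ℝ :=
  ∑ j : Fin 2, ‖Complex.I * g j x + (vectorPotential B x j : ℂ) * u x‖ ^ 2

/-- Cauchy–Schwarz on `cos θ ∂₁u + sin θ ∂₂u`; the defect is `|sin θ ∂₁u - cos θ ∂₂u|²`. -/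
lemma sq_norm_polarFunR_le (u : Plane → ℂ) (r θ : ℝ) :
    ‖polarFunR u r θ‖ ^ 2 ≤ ∑ j, ‖partialDerivC u j (r • unitVec θ)‖ ^ 2 := by
  rw [polarFunR, fderiv_apply_eq, Fin.sum_univ_two]
  simp only [sq_norm_eq, unitVec_zero, unitVec_one]
  simp [-Complex.ofReal_cos, -Complex.ofReal_sin]
  nlinarith [Real.sin_sq_add_cos_sq θ,
    sq_nonneg (Real.sin θ * (partialDerivC u 0 (r • unitVec θ)).re -
      Real.cos θ * (partialDerivC u 1 (r • unitVec θ)).re),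
    sq_nonneg (Real.sin θ * (partialDerivC u 0 (r • unitVec θ)).im -
      Real.cos θ * (partialDerivC u 1 (r • unitVec θ)).im)]

namespace IsRadialProfile

variable {b : ℝ → ℝ} {R : ℝ}

/-- The vector potential is purely tangential with size `Φ/r`, so the radial component is `U_r` and
the angular one `(-i U_θ - ΦU)/r`. The zero coefficients give the shape expected by
`integral_sq_combination`. -/
lemma kineticDensity_polar (hb : IsRadialProfile b R) (u : Plane → ℂ) {r : ℝ} (hr : 0 < r)
    (θ : ℝ) :
    kineticDensity (radialField b) u (partialDerivC u) (r • unitVec θ) =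
      ‖(1 : ℝ) * polarFunR u r θ + (0 : ℝ) * (-Complex.I * polarFunT u r θ) +
        (0 : ℝ) * polarFun u r θ‖ ^ 2 +
      ‖(0 : ℝ) * polarFunR u r θ + (1 / r : ℝ) * (-Complex.I * polarFunT u r θ) +
        (-radialFlux b r / r : ℝ) * polarFun u r θ‖ ^ 2 := by
  have hn : ‖r • unitVec θ‖ = r := by rw [norm_smul, norm_unitVec, mul_one, Real.norm_of_nonneg hr.le]
  rw [kineticDensity, Fin.sum_univ_two, hb.vectorPotential_zero, hb.vectorPotential_one, hn,
    polarFunR, polarFunT, fderiv_apply_eq, fderiv_apply_eq, polarFun]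
  generalize partialDerivC u 0 (r • unitVec θ) = g0
  generalize partialDerivC u 1 (r • unitVec θ) = g1
  generalize u (r • unitVec θ) = v
  have hcs := Real.sin_sq_add_cos_sq θ
  -- Naming `1/r` and `-Φ/r` as opaque constants makes the final identity polynomial, modulo only
  -- `sin² + cos² = 1`.
  obtain ⟨k, hk⟩ : ∃ k, k = 1 / r := ⟨_, rfl⟩
  obtain ⟨c, hc⟩ : ∃ c, c = -radialFlux b r / r := ⟨_, rfl⟩
  have hkr : k * r = 1 := by rw [hk]; field_simp
  have h0 : -(radialFlux b r / r ^ 2 * (r • unitVec θ) 1) = c * Real.sin θ := by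
    rw [hc]
    simp
    field_simp
  have h1 : radialFlux b r / r ^ 2 * (r • unitVec θ) 0 = -(c * Real.cos θ) := by
    rw [hc]
    simp
    field_simp
  have h2 : ∀ z : ℂ, (k : ℂ) * (-Complex.I * (r * z)) = -Complex.I * z := by
    intro z
    have : (k : ℂ) * r = 1 := by exact_mod_cast hkr
    linear_combination (-Complex.I * z) * this
  rw [h0, h1, ← hk, ← hc, h2]
  simp only [sq_norm_eq, unitVec_zero, unitVec_one, perpVec_zero, perpVec_one]
  simp [-Complex.ofReal_cos, -Complex.ofReal_sin]
  linear_combination (c ^ 2 * (v.re ^ 2 + v.im ^ 2) -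
    (g0.re ^ 2 + g0.im ^ 2 + g1.re ^ 2 + g1.im ^ 2)) * hcs

end IsRadialProfile

/-! ### The Hardy inequality for test functions -/

lemma integrableOn_polar {f : Plane → ℝ} (hm : Measurable f) (hi : Integrable f) :
    IntegrableOn (fun r => r * ∫ θ in (-π)..π, f (r • unitVec θ)) (Ioi 0) := by
  have h1 := (integrable_polar_iff hm.aestronglyMeasurable (measurable_fst.smul
    (hm.comp continuous_polar.measurable)).aestronglyMeasurable).1 hi
  refine h1.integral_prod_left.congr (ae_of_all _ fun r => ?_)
  simp only [smul_eq_mul]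
  rw [integral_const_mul, intervalIntegral.integral_of_le neg_pi_lt_pi.le,
    integral_Ioc_eq_integral_Ioo]

lemma integral_polar_iterated {f : Plane → ℝ} (hm : Measurable f) (hi : Integrable f) :
    ∫ x, f x = ∫ r in Ioi 0, r * ∫ θ in (-π)..π, f (r • unitVec θ) := by
  have h1 := (integrable_polar_iff hm.aestronglyMeasurable (measurable_fst.smul
    (hm.comp continuous_polar.measurable)).aestronglyMeasurable).1 hi
  rw [polarMeasure] at h1
  rw [integral_polar, polarMeasure, integral_prod _ h1]
  refine setIntegral_congr_fun measurableSet_Ioi fun r _ => ?_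
  simp only [smul_eq_mul]
  rw [integral_const_mul, intervalIntegral.integral_of_le neg_pi_lt_pi.le,
    integral_Ioc_eq_integral_Ioo]

/-- An integral over the half-line of a function vanishing beyond `M`. -/
lemma setIntegral_Ioi_eq_intervalIntegral {f : ℝ → ℝ} {M : ℝ} (hM : 0 ≤ M)
    (hf : ∀ r, M ≤ r → f r = 0) : ∫ r in Ioi 0, f r = ∫ r in (0:ℝ)..M, f r := by
  rw [intervalIntegral.integral_of_le hM]
  refine setIntegral_eq_of_subset_of_forall_sdiff_eq_zero measurableSet_Ioi
    (fun r hr => hr.1) fun r hr => hf r ?_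
  by_contra h
  exact hr.2 ⟨hr.1, (not_le.1 h).le⟩

namespace IsPolarFunction

variable {U Ur Ut Urt : ℝ → ℝ → ℂ} {M : ℝ}

lemma continuous_circleRe (h : IsPolarFunction U Ur Ut Urt M) : Continuous (circleRe U Ur) := by
  have hc := h.cont
  have hcr := h.cont_r
  refine intervalIntegral.continuous_parametric_intervalIntegral_of_continuous' ?_ _ _
  simp only [Function.uncurry_def] at *
  fun_prop

/-- The flux function is only absolutely continuous, so integrating it by parts needs an absolutely
continuous partner; a continuous derivative makes `circleSq U` Lipschitz on compact intervals. -/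
lemma absolutelyContinuous_circleSq (h : IsPolarFunction U Ur Ut Urt M) (c d : ℝ) :
    AbsolutelyContinuousOnInterval (circleSq U) c d := by
  obtain ⟨C, hC⟩ := (isCompact_uIcc (a := c) (b := d)).exists_bound_of_continuousOn
    (continuous_const.mul h.continuous_circleRe : Continuous fun r => 2 * circleRe U Ur r).continuousOn
  refine LipschitzOnWith.absolutelyContinuousOnInterval (K := C.toNNReal) ?_
  refine (convex_uIcc c d).lipschitzOnWith_of_nnnorm_hasDerivWithin_le
    (fun r _ => (h.hasDerivAt_circleSq r).hasDerivWithinAt) fun r hr => ?_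
  rw [← NNReal.coe_le_coe, coe_nnnorm]
  exact (hC r hr).trans (Real.le_coe_toNNReal C)

end IsPolarFunction

namespace IsRadialProfile

variable {b : ℝ → ℝ} {R : ℝ} {U Ur Ut Urt : ℝ → ℝ → ℂ} {M : ℝ}

/-- Integration by parts for the field term. -/
lemma integral_field_eq (hb : IsRadialProfile b R) (h : IsPolarFunction U Ur Ut Urt M) :
    ∫ r in (0:ℝ)..M, b r * r * circleSq U r =
      -∫ r in (0:ℝ)..M, 2 * radialFlux b r * circleRe U Ur r := by
  have hi : IntervalIntegrable (fun t => b t * t) volume 0 M :=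
    hb.integrable_mul.intervalIntegrable
  have key := AbsolutelyContinuousOnInterval.integral_mul_deriv_eq_deriv_mul
    (hi.absolutelyContinuousOnInterval_intervalIntegral left_mem_uIcc)
    (h.absolutelyContinuous_circleSq 0 M)
  have hM : circleSq U M = 0 := by simp [circleSq, h.vanish M _ le_rfl]
  have e1 : ∫ x in (0:ℝ)..M, deriv (fun x => ∫ t in (0:ℝ)..x, b t * t) x * circleSq U x =
      ∫ r in (0:ℝ)..M, b r * r * circleSq U r := by
    refine intervalIntegral.integral_congr_ae ?_
    filter_upwards [hi.ae_hasDerivAt_integral] with x hx hx'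
    rw [(hx (uIoc_subset_uIcc hx') 0 left_mem_uIcc).deriv]
  have e2 : ∫ x in (0:ℝ)..M, (∫ t in (0:ℝ)..x, b t * t) * deriv (circleSq U) x =
      ∫ r in (0:ℝ)..M, 2 * radialFlux b r * circleRe U Ur r := by
    refine intervalIntegral.integral_congr fun x _ => ?_
    simp only [(h.hasDerivAt_circleSq x).deriv, radialFlux]
    ring
  rw [e1, e2, hM] at key
  simp at key
  linarith

end IsRadialProfile

lemma exists_isPolarFunction {u : Plane → ℂ} (hu : ContDiff ℝ ∞ u) (hs : HasCompactSupport u)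
    (R : ℝ) : ∃ M, R ≤ M ∧ IsPolarFunction (polarFun u) (polarFunR u) (polarFunT u)
      (polarFunRT u) M := by
  obtain ⟨M, hM⟩ := hs.isCompact.isBounded.subset_closedBall (0 : Plane)
  have h : ∀ x : Plane, max (M + 1) R ≤ ‖x‖ → x ∉ tsupport u := by
    intro x hx hx'
    have h1 := hM hx'
    rw [mem_closedBall_zero_iff] at h1
    linarith [le_max_left (M + 1) R]
  exact ⟨max (M + 1) R, le_max_right _ _, isPolarFunction_polarFun hu
    (fun x hx => image_eq_zero_of_notMem_tsupport (h x hx))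
    fun x hx => fderiv_of_notMem_tsupport ℝ (h x hx)⟩

lemma continuous_partialDerivC {u : Plane → ℂ} (hu : ContDiff ℝ ∞ u) (j : Fin 2) :
    Continuous (partialDerivC u j) :=
  (hu.continuous_fderiv (by simp)).clm_apply continuous_const

lemma hasCompactSupport_partialDerivC {u : Plane → ℂ} (hs : HasCompactSupport u) (j : Fin 2) :
    HasCompactSupport (partialDerivC u j) :=
  hs.fderiv_apply ℝ _

namespace IsRadialProfile

variable {b : ℝ → ℝ} {R : ℝ}

lemma kineticDensity_le (hb : IsRadialProfile b R) : ∃ C, 0 ≤ C ∧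
    ∀ (u : Plane → ℂ) (g : Fin 2 → Plane → ℂ) (x : Plane),
      kineticDensity (radialField b) u g x ≤ C * (‖u x‖ ^ 2 + ∑ j, ‖g j x‖ ^ 2) := by
  obtain ⟨C, hC0, hC⟩ := hb.exists_abs_vectorPotential_le
  refine ⟨2 + 4 * C ^ 2, by positivity, fun u g x => ?_⟩
  have h : ∀ j, ‖Complex.I * g j x + (vectorPotential (radialField b) x j : ℂ) * u x‖ ^ 2 ≤
      2 * ‖g j x‖ ^ 2 + 2 * (C ^ 2 * ‖u x‖ ^ 2) := by
    intro j
    have h1 : ‖Complex.I * g j x + (vectorPotential (radialField b) x j : ℂ) * u x‖ ≤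
        ‖g j x‖ + C * ‖u x‖ := by
      refine (norm_add_le _ _).trans ?_
      rw [norm_mul, norm_mul, Complex.norm_I, one_mul, Complex.norm_real, Real.norm_eq_abs]
      gcongr
      exact hC x j
    calc _ ≤ (‖g j x‖ + C * ‖u x‖) ^ 2 := by gcongr
      _ ≤ _ := by nlinarith [sq_nonneg (‖g j x‖ - C * ‖u x‖)]
  rw [kineticDensity, Fin.sum_univ_two, Fin.sum_univ_two]
  have := h 0
  have := h 1
  nlinarith [sq_nonneg (C * ‖g 0 x‖), sq_nonneg (C * ‖g 1 x‖), sq_nonneg ‖u x‖]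

lemma kineticDensity_nonneg (B : Plane → ℝ) (u : Plane → ℂ) (g : Fin 2 → Plane → ℂ)
    (x : Plane) : 0 ≤ kineticDensity B u g x :=
  Finset.sum_nonneg fun _ _ => by positivity

lemma integrable_kineticDensity (hb : IsRadialProfile b R) {u : Plane → ℂ}
    {g : Fin 2 → Plane → ℂ} (hu : MemLp u 2) (hg : ∀ j, MemLp (g j) 2) :
    Integrable (kineticDensity (radialField b) u g) := by
  obtain ⟨C, hC0, hC⟩ := hb.kineticDensity_le
  have h1 : Integrable fun x => C * (‖u x‖ ^ 2 + ∑ j, ‖g j x‖ ^ 2) :=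
    (((memLp_two_iff_integrable_sq_norm hu.1).1 hu).add (integrable_finsetSum _ fun j _ =>
      (memLp_two_iff_integrable_sq_norm (hg j).1).1 (hg j))).const_mul C
  refine h1.mono' ?_ (ae_of_all _ fun x => ?_)
  · have hA : ∀ j, AEStronglyMeasurable
        (fun x => (vectorPotential (radialField b) x j : ℂ)) volume := fun j =>
      (Complex.measurable_ofReal.comp (hb.measurable_vectorPotential j)).aestronglyMeasurable
    refine Finset.aestronglyMeasurable_fun_sum _ fun j _ => ?_
    exact ((((hg j).1.const_mul _).add ((hA j).mul hu.1)).norm.pow 2)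
  · rw [Real.norm_of_nonneg (kineticDensity_nonneg _ _ _ _)]
    exact hC u g x

section Smooth

variable {u : Plane → ℂ} {M : ℝ}

/-- `radialDensity` already contains the field term in its integrated-by-parts form; adding `2 Φ
Re⟨U, U_r⟩` removes it and leaves the kinetic part alone. -/
lemma integral_kineticDensity_circle (hb : IsRadialProfile b R)
    (h : IsPolarFunction (polarFun u) (polarFunR u) (polarFunT u) (polarFunRT u) M) {r : ℝ}
    (hr : 0 < r) :
    r * ∫ θ in (-π)..π, kineticDensity (radialField b) u (partialDerivC u) (r • unitVec θ) =
      radialDensity b (polarFun u) (polarFunR u) (polarFunT u) r +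
        2 * radialFlux b r * circleRe (polarFun u) (polarFunR u) r := by
  have hc := h.cont.uncurry_left r
  have hcr := h.cont_r.uncurry_left r
  have hct := h.cont_t.uncurry_left r
  simp only [hb.kineticDensity_polar u hr]
  rw [intervalIntegral.integral_add (Continuous.intervalIntegrable (by fun_prop) _ _)
    (Continuous.intervalIntegrable (by fun_prop) _ _), h.integral_sq_combination,
    h.integral_sq_combination, radialDensity]
  field_simp
  ring

lemma integrable_field_of_bounded (hb : IsRadialProfile b R) (hu : Continuous u)
    (hs : HasCompactSupport u) : Integrable fun x => radialField b x * ‖u x‖ ^ 2 := by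
  obtain ⟨C, hC⟩ := hs.exists_bound_of_continuous hu
  refine hb.integrable_radialField.mul_bdd (c := C ^ 2) ?_ (ae_of_all _ fun x => ?_)
  · exact (hu.norm.pow 2).aestronglyMeasurable
  · rw [norm_pow, norm_norm]
    exact pow_le_pow_left₀ (norm_nonneg _) (hC x) 2

lemma integral_field_polar (hb : IsRadialProfile b R) (hu : ContDiff ℝ ∞ u)
    (hs : HasCompactSupport u) (hM0 : 0 ≤ M)
    (h : IsPolarFunction (polarFun u) (polarFunR u) (polarFunT u) (polarFunRT u) M) :
    ∫ x, radialField b x * ‖u x‖ ^ 2 =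
      -∫ r in (0:ℝ)..M, 2 * radialFlux b r * circleRe (polarFun u) (polarFunR u) r := by
  have hm : Measurable fun x => radialField b x * ‖u x‖ ^ 2 :=
    hb.measurable_radialField.mul (hu.continuous.norm.pow 2).measurable
  rw [← hb.integral_field_eq h, integral_polar_iterated hm
    (hb.integrable_field_of_bounded hu.continuous hs), ← setIntegral_Ioi_eq_intervalIntegral hM0]
  · refine setIntegral_congr_fun measurableSet_Ioi fun r hr => ?_
    have hr' : ‖r‖ = r := Real.norm_of_nonneg (le_of_lt hr)
    simp only [radialField, norm_smul, norm_unitVec, mul_one, hr']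
    rw [intervalIntegral.integral_const_mul, circleSq]
    simp only [polarFun]
    ring
  · intro r hr
    simp [circleSq, h.vanish r _ hr]

/-- The field term is controlled by the Sobolev norm. -/
lemma exists_integral_field_le (hb : IsRadialProfile b R) : ∃ C, 0 ≤ C ∧
    ∀ u : Plane → ℂ, ContDiff ℝ ∞ u → HasCompactSupport u →
      ∫ x, radialField b x * ‖u x‖ ^ 2 ≤
        C * ∫ x, (‖u x‖ ^ 2 + ∑ j, ‖partialDerivC u j x‖ ^ 2) := by
  obtain ⟨C, hC0, hC⟩ := hb.exists_radialFlux_div_le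
  refine ⟨C, hC0, fun u hu hs => ?_⟩
  obtain ⟨M, hRM, h⟩ := exists_isPolarFunction hu hs R
  have hM0 : 0 ≤ M := hb.pos.le.trans hRM
  have hcu := hu.continuous
  have hcg := continuous_partialDerivC hu
  have hcont : Continuous fun x => ‖u x‖ ^ 2 + ∑ j, ‖partialDerivC u j x‖ ^ 2 := by
    fun_prop
  have hint : Integrable fun x => ‖u x‖ ^ 2 + ∑ j, ‖partialDerivC u j x‖ ^ 2 := by
    refine Integrable.add ?_ (integrable_finsetSum _ fun j _ => ?_)
    · exact (memLp_two_iff_integrable_sq_norm hcu.aestronglyMeasurable).1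
        (hcu.memLp_of_hasCompactSupport hs)
    · exact (memLp_two_iff_integrable_sq_norm (hcg j).aestronglyMeasurable).1
        ((hcg j).memLp_of_hasCompactSupport (hasCompactSupport_partialDerivC hs j))
  rw [hb.integral_field_polar hu hs hM0 h, integral_polar_iterated hcont.measurable hint,
    ← intervalIntegral.integral_neg, intervalIntegral.integral_of_le hM0, ← integral_const_mul]
  have hint' := (integrableOn_polar hcont.measurable hint).const_mul C
  refine (setIntegral_mono_on ?_ (hint'.mono_measure (Measure.restrict_mono
    (fun _ hr => hr.1 : Ioc 0 M ⊆ Ioi 0) le_rfl)) measurableSet_Ioc fun r hr => ?_).trans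
    (setIntegral_mono_set hint' ?_ (LE.le.eventuallyLE (fun _ hr => hr.1 : Ioc 0 M ⊆ Ioi 0)))
  · exact (((continuous_const.mul hb.continuous_radialFlux).mul
      h.continuous_circleRe).neg.integrableOn_Icc).mono_set Ioc_subset_Icc_self
  · have hr0 : 0 < r := hr.1
    -- Nonnegativity of the integral of `|U_r + U|²` bounds `-2 Re⟨U, U_r⟩`; together with `Φ ≤ C
    -- r`, this supplies the factor `r` of the area element.
    have h1 := h.combination_nonneg r 1 0 1
    have h2 : radialFlux b r ≤ C * r := (div_le_iff₀ hr0).1 (hC r)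
    have hc := h.cont.uncurry_left r
    have hcr := h.cont_r.uncurry_left r
    have h3 : circleSq (polarFun u) r + circleSq (polarFunR u) r ≤ ∫ θ in (-π)..π,
        (‖u (r • unitVec θ)‖ ^ 2 + ∑ j, ‖partialDerivC u j (r • unitVec θ)‖ ^ 2) := by
      have hcuv := continuous_unitVec
      rw [circleSq, circleSq, ← intervalIntegral.integral_add
        (Continuous.intervalIntegrable (by fun_prop) _ _)
        (Continuous.intervalIntegrable (by fun_prop) _ _)]
      refine intervalIntegral.integral_mono_on neg_pi_lt_pi.le
        (Continuous.intervalIntegrable (by fun_prop) _ _)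
        (Continuous.intervalIntegrable (by fun_prop) _ _) fun θ _ => ?_
      exact add_le_add le_rfl (sq_norm_polarFunR_le u r θ)
    have h4 : -(2 * circleRe (polarFun u) (polarFunR u) r) ≤
        circleSq (polarFun u) r + circleSq (polarFunR u) r := by linarith
    have h5 : 0 ≤ circleSq (polarFun u) r + circleSq (polarFunR u) r :=
      add_nonneg (circleSq_nonneg _ _) (circleSq_nonneg _ _)
    calc -(2 * radialFlux b r * circleRe (polarFun u) (polarFunR u) r)
        = radialFlux b r * (-(2 * circleRe (polarFun u) (polarFunR u) r)) := by ring
      _ ≤ radialFlux b r * (circleSq (polarFun u) r + circleSq (polarFunR u) r) :=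
          mul_le_mul_of_nonneg_left h4 (hb.radialFlux_nonneg r)
      _ ≤ C * r * (circleSq (polarFun u) r + circleSq (polarFunR u) r) :=
          mul_le_mul_of_nonneg_right h2 h5
      _ ≤ C * r * _ := mul_le_mul_of_nonneg_left h3 (by positivity)
      _ = _ := by ring
  · filter_upwards [ae_restrict_mem measurableSet_Ioi] with r hr
    have : 0 ≤ r := le_of_lt hr
    exact mul_nonneg hC0 (mul_nonneg this
      (intervalIntegral.integral_nonneg neg_pi_lt_pi.le fun _ _ => by positivity))

lemma integrable_weight {u : Plane → ℂ} (hR : 0 < R) (hu : MemLp u 2) :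
    Integrable fun x => ‖u x‖ ^ 2 / (R ^ 2 + ‖x‖ ^ 2) := by
  have h1 := (memLp_two_iff_integrable_sq_norm hu.1).1 hu
  simp only [div_eq_mul_inv]
  refine h1.mul_bdd (c := (R ^ 2)⁻¹) ?_ (ae_of_all _ fun x => ?_)
  · refine Continuous.aestronglyMeasurable (Continuous.inv₀ (by fun_prop) fun x => ?_)
    positivity
  · rw [Real.norm_of_nonneg (by positivity)]
    gcongr
    linarith [sq_nonneg ‖x‖]

/-- The Hardy inequality for smooth compactly supported functions. -/
lemma hardy_of_contDiff (hb : IsRadialProfile b R) (hu : ContDiff ℝ ∞ u)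
    (hs : HasCompactSupport u) :
    Real.exp (2 * (radialPotential b R - radialPotential b 0)) *
        distInt (∫ t, b t * t) ^ 2 * ∫ x, ‖u x‖ ^ 2 / (R ^ 2 + ‖x‖ ^ 2) ≤
      (∫ x, kineticDensity (radialField b) u (partialDerivC u) x) +
        ∫ x, radialField b x * ‖u x‖ ^ 2 := by
  obtain ⟨M, hRM, h⟩ := exists_isPolarFunction hu hs R
  have hM0 : 0 ≤ M := hb.pos.le.trans hRM
  have hcu := hu.continuous
  have hcg := continuous_partialDerivC hu
  have hL : MemLp u 2 := hcu.memLp_of_hasCompactSupport hs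
  have hLg : ∀ j, MemLp (partialDerivC u j) 2 := fun j =>
    (hcg j).memLp_of_hasCompactSupport (hasCompactSupport_partialDerivC hs j)
  have hkm : Measurable (kineticDensity (radialField b) u (partialDerivC u)) := by
    refine Finset.measurable_fun_sum _ fun j _ => ?_
    have h1 := Complex.measurable_ofReal.comp (hb.measurable_vectorPotential j)
    exact (((hcg j).measurable.const_mul _).add (h1.mul hcu.measurable)).norm.pow_const 2
  have hki := hb.integrable_kineticDensity hL hLg
  have hfc : Continuous fun r => 2 * radialFlux b r * circleRe (polarFun u) (polarFunR u) r :=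
    (continuous_const.mul hb.continuous_radialFlux).mul h.continuous_circleRe
  have hio : IntegrableOn (fun r => radialDensity b (polarFun u) (polarFunR u) (polarFunT u) r +
      2 * radialFlux b r * circleRe (polarFun u) (polarFunR u) r) (Ioi 0) :=
    (integrableOn_polar hkm hki).congr_fun
      (fun r hr => hb.integral_kineticDensity_circle h hr) measurableSet_Ioi
  -- Integrability across the factor `1/r` at the origin is inherited from that of the kinetic
  -- density in the plane.
  have hrd : IntegrableOn (radialDensity b (polarFun u) (polarFunR u) (polarFunT u))
      (Ioc 0 M) := by
    have := (hio.mono_set (fun _ hr => hr.1 : Ioc 0 M ⊆ Ioi 0)).sub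
      ((hfc.integrableOn_Icc (a := 0) (b := M)).mono_set Ioc_subset_Icc_self)
    refine this.congr (ae_of_all _ fun r => ?_)
    simp
  have hrd' : IntervalIntegrable (radialDensity b (polarFun u) (polarFunR u) (polarFunT u))
      volume 0 M := (intervalIntegrable_iff_integrableOn_Ioc_of_le hM0).2 hrd
  have hkin : ∫ x, kineticDensity (radialField b) u (partialDerivC u) x =
      (∫ r in (0:ℝ)..M, radialDensity b (polarFun u) (polarFunR u) (polarFunT u) r) +
        ∫ r in (0:ℝ)..M, 2 * radialFlux b r * circleRe (polarFun u) (polarFunR u) r := by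
    rw [← intervalIntegral.integral_add hrd' (hfc.intervalIntegrable _ _),
      integral_polar_iterated hkm hki, ← setIntegral_Ioi_eq_intervalIntegral hM0]
    · exact setIntegral_congr_fun measurableSet_Ioi
        fun r hr => hb.integral_kineticDensity_circle h hr
    · intro r hr
      simp [radialDensity, circleSq, circleIm, circleRe, h.vanish r _ hr, h.vanish_r r _ hr,
        h.vanish_t r _ hr]
  have hw : ∫ x, ‖u x‖ ^ 2 / (R ^ 2 + ‖x‖ ^ 2) =
      ∫ r in (0:ℝ)..M, circleSq (polarFun u) r * (r / (R ^ 2 + r ^ 2)) := by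
    have hm : Measurable fun x : Plane => ‖u x‖ ^ 2 / (R ^ 2 + ‖x‖ ^ 2) :=
      (hcu.norm.pow 2).measurable.div (by fun_prop)
    rw [integral_polar_iterated hm (integrable_weight hb.pos hL),
      ← setIntegral_Ioi_eq_intervalIntegral hM0]
    · refine setIntegral_congr_fun measurableSet_Ioi fun r hr => ?_
      have hr' : ‖r‖ = r := Real.norm_of_nonneg (le_of_lt hr)
      simp only [norm_smul, norm_unitVec, mul_one, hr']
      rw [intervalIntegral.integral_div, circleSq]
      simp only [polarFun]
      ring
    · intro r hr
      simp [circleSq, h.vanish r _ hr]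
  have key := hb.le_integral_radialDensity h hRM rfl rfl
    ((integrableOn_Icc_iff_integrableOn_Ioc).2 hrd)
  rw [hw, hkin, hb.integral_field_polar hu hs hM0 h]
  linarith

end Smooth

end IsRadialProfile

end PauliHardy

namespace PauliHardy

open Set Filter Topology Real
open scoped SchwartzMap Laplacian LineDeriv

/-! ### Density of test functions in H¹ -/

lemma integrable_ofReal_smul {f : Plane → ℝ} {a : Plane → ℂ} (hf : MemLp f 2) (ha : MemLp a 2) :
    Integrable fun x => f x • a x :=
  memLp_one_iff_integrable.1 (ha.smul hf)

lemma integrable_mul_two {f a : Plane → ℂ} (hf : MemLp f 2) (ha : MemLp a 2) :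
    Integrable fun x => f x * a x :=
  memLp_one_iff_integrable.1 (ha.smul hf)

/-- The rescaled cut-off functions. -/
noncomputable def cutoff (n : ℕ) (x : Plane) : ℝ :=
  (⟨1, 2, by norm_num, by norm_num⟩ : ContDiffBump (0 : Plane)) (((n : ℝ) + 1)⁻¹ • x)

lemma contDiff_cutoff (n : ℕ) : ContDiff ℝ ∞ (cutoff n) :=
  (ContDiffBump.contDiff _).comp (contDiff_const_smul _)

lemma hasCompactSupport_cutoff (n : ℕ) : HasCompactSupport (cutoff n) :=
  (ContDiffBump.hasCompactSupport _).comp_homeomorph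
    (Homeomorph.smulOfNeZero ((n : ℝ) + 1)⁻¹ (by positivity))

lemma abs_cutoff_le (n : ℕ) (x : Plane) : |cutoff n x| ≤ 1 := by
  rw [cutoff, abs_of_nonneg (ContDiffBump.nonneg _)]
  exact ContDiffBump.le_one _

lemma tendsto_inv_natCast_add_one : Tendsto (fun n : ℕ => ((n : ℝ) + 1)⁻¹) atTop (𝓝 0) := by
  simpa [one_div] using tendsto_one_div_add_atTop_nhds_zero_nat (𝕜 := ℝ)

lemma tendsto_cutoff (x : Plane) : Tendsto (fun n => cutoff n x) atTop (𝓝 1) := by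
  have h1 : Tendsto (fun n : ℕ => ((n : ℝ) + 1)⁻¹ • x) atTop (𝓝 0) := by
    simpa using tendsto_inv_natCast_add_one.smul_const x
  set χ : ContDiffBump (0 : Plane) := ⟨1, 2, by norm_num, by norm_num⟩
  have h2 := (χ.continuous.tendsto 0).comp h1
  rwa [χ.one_of_mem_closedBall (by simp [χ.rIn_pos.le])] at h2

lemma exists_abs_partialDeriv_cutoff_le : ∃ C, 0 ≤ C ∧ ∀ n j x,
    |partialDeriv j (cutoff n) x| ≤ C * ((n : ℝ) + 1)⁻¹ := by
  set χ : ContDiffBump (0 : Plane) := ⟨1, 2, by norm_num, by norm_num⟩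
  have hχ : ContDiff ℝ ∞ χ := χ.contDiff
  obtain ⟨C, hC⟩ := (χ.hasCompactSupport.fderiv ℝ).exists_bound_of_continuous
    (hχ.continuous_fderiv (by simp))
  refine ⟨C, (norm_nonneg _).trans (hC 0), fun n j x => ?_⟩
  have h1 : HasFDerivAt (cutoff n) ((fderiv ℝ χ (((n : ℝ) + 1)⁻¹ • x)).comp
      (((n : ℝ) + 1)⁻¹ • ContinuousLinearMap.id ℝ Plane)) x :=
    ((hχ.differentiable (by simp)) _).hasFDerivAt.comp x
      ((hasFDerivAt_id x).const_smul (((n : ℝ) + 1)⁻¹))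
  rw [partialDeriv, h1.fderiv]
  simp only [ContinuousLinearMap.comp_apply, smul_apply, ContinuousLinearMap.id_apply, map_smul,
    smul_eq_mul]
  rw [abs_mul, abs_of_pos (by positivity), mul_comm]
  gcongr
  have h2 := (fderiv ℝ χ (((n : ℝ) + 1)⁻¹ • x)).le_opNorm (EuclideanSpace.single j (1 : ℝ))
  rw [show ‖EuclideanSpace.single j (1 : ℝ)‖ = 1 by simp, mul_one] at h2
  exact h2.trans (hC _)

lemma partialDeriv_mul {f g : Plane → ℝ} (hf : Differentiable ℝ f) (hg : Differentiable ℝ g)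
    (j : Fin 2) (x : Plane) :
    partialDeriv j (fun x => f x * g x) x = partialDeriv j f x * g x + f x * partialDeriv j g x := by
  rw [partialDeriv, fderiv_fun_mul (hf x) (hg x)]
  simp [partialDeriv]
  ring

/-- A first order weak identity with square integrable coefficients, valid for test functions,
extends to smooth functions in `H¹`. -/
lemma integral_eq_zero_of_testFunction {a : Plane → ℂ} {c : Fin 2 → Plane → ℂ} (ha : MemLp a 2)
    (hc : ∀ j, MemLp (c j) 2)
    (h : ∀ φ : Plane → ℝ, ContDiff ℝ ∞ φ → HasCompactSupport φ →
      ∫ x, (φ x • a x + ∑ j, partialDeriv j φ x • c j x) = 0)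
    {f : Plane → ℝ} (hf : ContDiff ℝ ∞ f) (hf2 : MemLp f 2)
    (hf2' : ∀ j, MemLp (partialDeriv j f) 2) :
    ∫ x, (f x • a x + ∑ j, partialDeriv j f x • c j x) = 0 := by
  obtain ⟨C, hC0, hC⟩ := exists_abs_partialDeriv_cutoff_le
  have hfd : Differentiable ℝ f := hf.differentiable (by simp)
  have hχd : ∀ n, Differentiable ℝ (cutoff n) := fun n =>
    (contDiff_cutoff n).differentiable (by simp)
  -- Dominated convergence for `cutoff n * f`: the gradient of the cutoff is bounded by `C / (n + 1)
  -- ≤ C`, which gives the majorant and also makes its contribution vanish in the limit.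
  have hlim : Tendsto (fun n => ∫ x, ((cutoff n x * f x) • a x +
      ∑ j, partialDeriv j (fun x => cutoff n x * f x) x • c j x)) atTop
      (𝓝 (∫ x, (f x • a x + ∑ j, partialDeriv j f x • c j x))) := by
    refine tendsto_integral_of_dominated_convergence
      (fun x => ‖f x • a x‖ + ∑ j, (C * ‖f x • c j x‖ + ‖partialDeriv j f x • c j x‖))
      (fun n => ?_) ?_ (fun n => ae_of_all _ fun x => ?_) (ae_of_all _ fun x => ?_)
    · have hcd : ∀ j, Continuous (partialDeriv j fun x => cutoff n x * f x) := fun j =>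
        (((contDiff_cutoff n).mul hf).continuous_fderiv (by simp)).clm_apply continuous_const
      refine (((contDiff_cutoff n).continuous.mul hf.continuous).aestronglyMeasurable.smul
        ha.1).add (Finset.aestronglyMeasurable_fun_sum _ fun j _ => ?_)
      exact (hcd j).aestronglyMeasurable.smul (hc j).1
    · refine (integrable_ofReal_smul hf2 ha).norm.add (integrable_finsetSum _ fun j _ => ?_)
      exact ((integrable_ofReal_smul hf2 (hc j)).norm.const_mul C).add
        (integrable_ofReal_smul (hf2' j) (hc j)).norm
    · refine (norm_add_le _ _).trans (add_le_add ?_ ((norm_sum_le _ _).trans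
        (Finset.sum_le_sum fun j _ => ?_)))
      · rw [norm_smul, norm_smul, norm_mul, mul_assoc]
        exact mul_le_of_le_one_left (by positivity) (abs_cutoff_le n x)
      · rw [partialDeriv_mul (hχd n) hfd, add_smul]
        refine (norm_add_le _ _).trans (add_le_add ?_ ?_)
        · rw [norm_smul, norm_smul, norm_mul, mul_assoc]
          refine mul_le_mul_of_nonneg_right ((hC n j x).trans ?_) (by positivity)
          refine mul_le_of_le_one_right hC0 (inv_le_one_of_one_le₀ ?_)
          linarith [Nat.cast_nonneg (α := ℝ) n]
        · rw [norm_smul, norm_smul, norm_mul, mul_assoc]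
          exact mul_le_of_le_one_left (by positivity) (abs_cutoff_le n x)
    · have h1 : Tendsto (fun n => cutoff n x * f x) atTop (𝓝 (f x)) := by
        simpa using (tendsto_cutoff x).mul_const (f x)
      refine (h1.smul_const _).add (tendsto_finsetSum _ fun j _ => Tendsto.smul_const ?_ _)
      simp only [partialDeriv_mul (hχd _) hfd]
      have h2 : Tendsto (fun n => partialDeriv j (cutoff n) x) atTop (𝓝 0) := by
        refine squeeze_zero_norm (fun n => hC n j x) ?_
        simpa using tendsto_inv_natCast_add_one.const_mul C
      simpa using (h2.mul_const (f x)).add ((tendsto_cutoff x).mul_const (partialDeriv j f x))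
  refine tendsto_nhds_unique hlim ?_
  have : ∀ n, ∫ x, ((cutoff n x * f x) • a x +
      ∑ j, partialDeriv j (fun x => cutoff n x * f x) x • c j x) = 0 := fun n =>
    h _ ((contDiff_cutoff n).mul hf) ((hasCompactSupport_cutoff n).mul_right)
  simp only [this]
  exact tendsto_const_nhds

lemma schwartz_partialDerivC (ψ : 𝓢(Plane, ℂ)) (j : Fin 2) (x : Plane) :
    partialDerivC ψ j x = (∂_{EuclideanSpace.single j (1 : ℝ)} ψ : 𝓢(Plane, ℂ)) x :=
  (SchwartzMap.lineDerivOp_apply_eq_fderiv _ ψ x).symm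

lemma memLp_partialDerivC_schwartz (ψ : 𝓢(Plane, ℂ)) (j : Fin 2) :
    MemLp (partialDerivC ψ j) 2 := by
  have : partialDerivC ψ j = (∂_{EuclideanSpace.single j (1 : ℝ)} ψ : 𝓢(Plane, ℂ)) :=
    funext (schwartz_partialDerivC ψ j)
  rw [this]
  exact SchwartzMap.memLp _ 2 volume

lemma partialDeriv_re {ψ : Plane → ℂ} (hψ : Differentiable ℝ ψ) (j : Fin 2) (x : Plane) :
    partialDeriv j (fun x => (ψ x).re) x = (partialDerivC ψ j x).re := by
  have := (Complex.reCLM.hasFDerivAt (x := ψ x)).comp x (hψ x).hasFDerivAt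
  rw [partialDeriv, show (fun x => (ψ x).re) = Complex.reCLM ∘ ψ from rfl, this.fderiv]
  rfl

lemma partialDeriv_im {ψ : Plane → ℂ} (hψ : Differentiable ℝ ψ) (j : Fin 2) (x : Plane) :
    partialDeriv j (fun x => (ψ x).im) x = (partialDerivC ψ j x).im := by
  have := (Complex.imCLM.hasFDerivAt (x := ψ x)).comp x (hψ x).hasFDerivAt
  rw [partialDeriv, show (fun x => (ψ x).im) = Complex.imCLM ∘ ψ from rfl, this.fderiv]
  rfl

lemma integral_eq_zero_of_testFunction_schwartz {a : Plane → ℂ} {c : Fin 2 → Plane → ℂ}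
    (ha : MemLp a 2) (hc : ∀ j, MemLp (c j) 2)
    (h : ∀ φ : Plane → ℝ, ContDiff ℝ ∞ φ → HasCompactSupport φ →
      ∫ x, (φ x • a x + ∑ j, partialDeriv j φ x • c j x) = 0) (ψ : 𝓢(Plane, ℂ)) :
    ∫ x, (ψ x * a x + ∑ j, partialDerivC ψ j x * c j x) = 0 := by
  have hψ : ContDiff ℝ ∞ ψ := ψ.smooth'
  have hψd : Differentiable ℝ ψ := hψ.differentiable (by simp)
  have hL : MemLp ψ 2 := ψ.memLp 2
  have hre : MemLp (fun x => (ψ x).re) 2 := hL.re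
  have him : MemLp (fun x => (ψ x).im) 2 := hL.im
  have hre' : ∀ j, MemLp (partialDeriv j fun x => (ψ x).re) 2 := fun j =>
    ((memLp_partialDerivC_schwartz ψ j).re).ae_eq
      (ae_of_all _ fun x => (partialDeriv_re hψd j x).symm)
  have him' : ∀ j, MemLp (partialDeriv j fun x => (ψ x).im) 2 := fun j =>
    ((memLp_partialDerivC_schwartz ψ j).im).ae_eq
      (ae_of_all _ fun x => (partialDeriv_im hψd j x).symm)
  have h1 := integral_eq_zero_of_testFunction (f := fun x => (ψ x).re) ha hc h
    (Complex.reCLM.contDiff.comp hψ : ContDiff ℝ ∞ fun x => (ψ x).re) hre hre'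
  have h2 := integral_eq_zero_of_testFunction (f := fun x => (ψ x).im) ha hc h
    (Complex.imCLM.contDiff.comp hψ : ContDiff ℝ ∞ fun x => (ψ x).im) him him'
  have i1 : Integrable fun x => (ψ x).re • a x +
      ∑ j, partialDeriv j (fun x => (ψ x).re) x • c j x :=
    (integrable_ofReal_smul hre ha).add
      (integrable_finsetSum _ fun j _ => integrable_ofReal_smul (hre' j) (hc j))
  have i2 : Integrable fun x => (ψ x).im • a x +
      ∑ j, partialDeriv j (fun x => (ψ x).im) x • c j x :=
    (integrable_ofReal_smul him ha).add
      (integrable_finsetSum _ fun j _ => integrable_ofReal_smul (him' j) (hc j))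
  calc ∫ x, (ψ x * a x + ∑ j, partialDerivC ψ j x * c j x)
      = ∫ x, (((ψ x).re • a x + ∑ j, partialDeriv j (fun x => (ψ x).re) x • c j x) +
        Complex.I * ((ψ x).im • a x + ∑ j, partialDeriv j (fun x => (ψ x).im) x • c j x)) := by
        refine integral_congr_ae (ae_of_all _ fun x => ?_)
        simp only [Fin.sum_univ_two, partialDeriv_re hψd, partialDeriv_im hψd, Complex.real_smul]
        linear_combination (-a x) * Complex.re_add_im (ψ x) -
          c 0 x * Complex.re_add_im (partialDerivC ψ 0 x) -
          c 1 x * Complex.re_add_im (partialDerivC ψ 1 x)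
    _ = 0 := by
        rw [integral_add i1 (i2.const_mul _), integral_const_mul, h1, h2]
        simp

/-- The operator `1 - Δ` is onto on the Schwartz space. -/
lemma exists_sub_laplacian_eq (η : 𝓢(Plane, ℂ)) : ∃ ψ : 𝓢(Plane, ℂ), ψ - Δ ψ = η := by
  -- The symbol of `(1 - Δ)⁻¹`, in the Fourier convention where `-Δ` has symbol `‖2πξ‖²`. The
  -- identity `(2π)² ‖ξ‖² s = 1 - s` then gives `ψ - Δψ = η`.
  set s : Plane → ℝ := fun x => (1 + ‖(2 * π) • x‖ ^ 2) ^ (-1 : ℝ) with hs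
  have hst : s.HasTemperateGrowth := by
    have h1 := Function.hasTemperateGrowth_one_add_norm_sq_rpow Plane (-1)
    have h2 : Function.HasTemperateGrowth fun x : Plane => (2 * π) • x :=
      ((2 * π) • ContinuousLinearMap.id ℝ Plane).hasTemperateGrowth
    exact h1.comp h2
  have hn : Function.HasTemperateGrowth fun x : Plane => ‖x‖ ^ 2 :=
    Function.hasTemperateGrowth_norm_sq Plane
  refine ⟨SchwartzMap.fourierMultiplierCLM ℂ s η, ?_⟩
  rw [SchwartzMap.laplacian_eq_fourierMultiplierCLM,
    SchwartzMap.fourierMultiplierCLM_fourierMultiplierCLM_apply hn hst]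
  have h3 : (fun x : Plane => ‖x‖ ^ 2) * s = ((2 * π) ^ 2)⁻¹ • ((fun _ => 1) + (-1 : ℝ) • s) := by
    funext x
    have : 0 < 1 + ‖(2 * π) • x‖ ^ 2 := by positivity
    simp only [Pi.mul_apply, Pi.smul_apply, Pi.add_apply, hs, Real.rpow_neg_one, smul_eq_mul]
    have h4 : ‖(2 * π) • x‖ ^ 2 = (2 * π) ^ 2 * ‖x‖ ^ 2 := by
      rw [norm_smul, mul_pow, Real.norm_of_nonneg (by positivity)]
    rw [h4] at this ⊢
    field_simp
    ring
  have hs' : Function.HasTemperateGrowth ((-1 : ℝ) • s) := by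
    have := hst.neg
    simpa using this
  have hadd : SchwartzMap.fourierMultiplierCLM ℂ ((fun _ => 1) + (-1 : ℝ) • s) η =
      η - SchwartzMap.fourierMultiplierCLM ℂ s η := by
    simp only [SchwartzMap.fourierMultiplierCLM_apply]
    rw [SchwartzMap.smulLeftCLM_add (by fun_prop) hs', SchwartzMap.smulLeftCLM_smul hst]
    simp [FourierTransform.fourierInv_add, sub_eq_add_neg]
  have h5 : Function.HasTemperateGrowth ((fun _ : Plane => (1 : ℝ)) + (-1 : ℝ) • s) :=
    (Function.HasTemperateGrowth.const 1).add hs'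
  rw [h3, SchwartzMap.fourierMultiplierCLM_smul h5]
  simp only [smul_apply, smul_smul]
  rw [hadd, neg_mul, mul_inv_cancel₀ (by positivity), neg_one_smul]
  abel

/-- A square integrable vector field orthogonal to gradients in the Sobolev inner product which is
itself a gradient in `H¹` vanishes. -/
lemma ae_eq_zero_of_weak_eq {a : Plane → ℂ} {c : Fin 2 → Plane → ℂ}
    (ha : MemLp a 2) (hc : ∀ j, MemLp (c j) 2)
    (h1 : ∀ φ : Plane → ℝ, ContDiff ℝ ∞ φ → HasCompactSupport φ →
      ∫ x, (φ x • a x + ∑ j, partialDeriv j φ x • c j x) = 0)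
    (h2 : ∀ (j : Fin 2) (φ : Plane → ℝ), ContDiff ℝ ∞ φ → HasCompactSupport φ →
      ∫ x, (partialDeriv j φ x • a x + φ x • c j x) = 0) :
    a =ᵐ[volume] 0 ∧ ∀ j, c j =ᵐ[volume] 0 := by
  have e1 := integral_eq_zero_of_testFunction_schwartz ha hc h1
  have e2 : ∀ (j : Fin 2) (ψ : 𝓢(Plane, ℂ)),
      ∫ x, (partialDerivC ψ j x * a x + ψ x * c j x) = 0 := by
    intro j ψ
    -- The second identity has the form of the first, with `c j` as the undifferentiated coefficient
    -- and `a` placed in slot `j`.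
    have := integral_eq_zero_of_testFunction_schwartz (hc j)
      (c := fun i => if i = j then a else 0)
      (fun i => by split_ifs <;> simp [ha]) (fun φ hφ hφs => ?_) ψ
    · rw [← this]
      refine integral_congr_ae (ae_of_all _ fun x => ?_)
      simp only [ite_apply, mul_ite, Pi.zero_apply, mul_zero, Finset.sum_ite_eq',
        Finset.mem_univ, if_true]
      ring
    · rw [← h2 j φ hφ hφs]
      refine integral_congr_ae (ae_of_all _ fun x => ?_)
      simp only [ite_apply, smul_ite, Pi.zero_apply, smul_zero, Finset.sum_ite_eq',
        Finset.mem_univ, if_true]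
      abel
  have e3 : ∀ η : 𝓢(Plane, ℂ), ∫ x, η x * a x = 0 := by
    intro η
    obtain ⟨ψ, rfl⟩ := exists_sub_laplacian_eq η
    set d : Fin 2 → 𝓢(Plane, ℂ) := fun j => ∂_{EuclideanSpace.single j (1 : ℝ)} ψ with hd
    have hpd : ∀ j, partialDerivC ψ j = d j := fun j => funext (schwartz_partialDerivC ψ j)
    have hlap : Δ ψ = ∑ j, ∂_{EuclideanSpace.single j (1 : ℝ)} (d j) := by
      rw [SchwartzMap.laplacian_eq_sum (EuclideanSpace.basisFun (Fin 2) ℝ)]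
      simp [hd]
    have hm : ∀ (ζ : 𝓢(Plane, ℂ)) {f : Plane → ℂ}, MemLp f 2 → Integrable fun x => ζ x * f x :=
      fun ζ f hf => integrable_mul_two (ζ.memLp 2) hf
    have hm' : ∀ (ζ : 𝓢(Plane, ℂ)) (j : Fin 2), Integrable fun x => partialDerivC ζ j x * a x :=
      fun ζ j => integrable_mul_two (memLp_partialDerivC_schwartz ζ j) ha
    have f1 := e1 ψ
    have f2 := fun j => e2 j (d j)
    have hi1 : Integrable fun x => ψ x * a x + ∑ j, partialDerivC ψ j x * c j x :=
      (hm ψ ha).add (integrable_finsetSum _ fun j _ => by rw [hpd]; exact hm (d j) (hc j))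
    have hi2 : ∀ j, Integrable fun x => partialDerivC (d j) j x * a x + d j x * c j x :=
      fun j => (hm' (d j) j).add (hm (d j) (hc j))
    -- The first identity tested on `ψ` minus the second tested on each `∂_j ψ`: the terms with `c`
    -- cancel and `∫ (ψ - Δψ) a = 0` remains.
    have g1 : (∫ x, (ψ x * a x + ∑ j, partialDerivC ψ j x * c j x)) -
        ∑ j, ∫ x, (partialDerivC (d j) j x * a x + d j x * c j x) = 0 := by
      rw [f1, Finset.sum_eq_zero fun j _ => f2 j, sub_zero]
    rw [← integral_finsetSum _ fun j _ => hi2 j,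
      ← integral_sub hi1 (integrable_finsetSum _ fun j _ => hi2 j)] at g1
    rw [← g1]
    refine integral_congr_ae (ae_of_all _ fun x => ?_)
    simp only [hlap, Fin.sum_univ_two, sub_apply, add_apply, schwartz_partialDerivC]
    ring
  have ha0 : a =ᵐ[volume] 0 := by
    refine ae_eq_zero_of_integral_contDiff_smul_eq_zero
      (ha.locallyIntegrable one_le_two) fun φ hφ hφs => ?_
    have hφ' : ContDiff ℝ ∞ fun x => (φ x : ℂ) := Complex.ofRealCLM.contDiff.comp hφ
    have hφs' : HasCompactSupport fun x => (φ x : ℂ) := hφs.comp_left Complex.ofReal_zero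
    exact e3 (hφs'.toSchwartzMap hφ')
  refine ⟨ha0, fun j => ?_⟩
  refine ae_eq_zero_of_integral_contDiff_smul_eq_zero
    ((hc j).locallyIntegrable one_le_two) fun φ hφ hφs => ?_
  rw [← h2 j φ hφ hφs]
  refine integral_congr_ae ?_
  filter_upwards [ha0] with x hx
  simp [hx]

/-- Triples of square integrable functions, containing the pairs `(u, ∇u)`. -/
abbrev SobolevAmbient : Type := PiLp 2 fun _ : Fin 3 => Lp ℂ 2 (volume : Measure Plane)

/-- The triple of a function and a vector field. -/
noncomputable def sobolevTriple {u : Plane → ℂ} {g : Fin 2 → Plane → ℂ} (hu : MemLp u 2)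
    (hg : ∀ j, MemLp (g j) 2) : SobolevAmbient :=
  WithLp.toLp 2 (Fin.cons (hu.toLp u) fun j => (hg j).toLp (g j))

lemma inner_sobolevTriple {u : Plane → ℂ} {g : Fin 2 → Plane → ℂ} (hu : MemLp u 2)
    (hg : ∀ j, MemLp (g j) 2) (z : SobolevAmbient) :
    inner ℂ (sobolevTriple hu hg) z = ∫ x, (z 0 x * starRingEnd ℂ (u x) +
      ∑ j : Fin 2, z j.succ x * starRingEnd ℂ (g j x)) := by
  have hi : ∀ (f : Plane → ℂ) (hf : MemLp f 2) (w : Lp ℂ 2 (volume : Measure Plane)),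
      Integrable (fun x => w x * starRingEnd ℂ (f x)) ∧
      inner ℂ (hf.toLp f) w = ∫ x, w x * starRingEnd ℂ (f x) := by
    intro f hf w
    refine ⟨integrable_mul_two (Lp.memLp w) hf.star, ?_⟩
    rw [L2.inner_def]
    refine integral_congr_ae ?_
    filter_upwards [hf.coeFn_toLp] with x hx
    rw [hx]
    rfl
  rw [PiLp.inner_apply, Fin.sum_univ_succ, integral_add (hi u hu _).1
    (integrable_finsetSum _ fun j _ => (hi (g j) (hg j) _).1),
    integral_finsetSum _ fun j _ => (hi (g j) (hg j) _).1]
  congr 1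
  · exact (hi u hu _).2
  · exact Finset.sum_congr rfl fun j _ => (hi (g j) (hg j) _).2

lemma partialDerivC_add {u v : Plane → ℂ} (hu : Differentiable ℝ u) (hv : Differentiable ℝ v)
    (j : Fin 2) (x : Plane) :
    partialDerivC (u + v) j x = partialDerivC u j x + partialDerivC v j x := by
  rw [partialDerivC, fderiv_add (hu x) (hv x)]
  rfl

lemma partialDerivC_smul {u : Plane → ℂ} (hu : Differentiable ℝ u) (c : ℂ)
    (j : Fin 2) (x : Plane) : partialDerivC (c • u) j x = c * partialDerivC u j x := by
  rw [partialDerivC, fderiv_const_smul (hu x)]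
  rfl

/-- The space of smooth compactly supported functions with their gradients. -/
noncomputable def smoothTriples : Submodule ℂ SobolevAmbient where
  carrier := {z | ∃ φ : Plane → ℂ, ContDiff ℝ ∞ φ ∧ HasCompactSupport φ ∧
    z 0 =ᵐ[volume] φ ∧ ∀ j : Fin 2, z j.succ =ᵐ[volume] partialDerivC φ j}
  zero_mem' := by
    refine ⟨0, contDiff_const, HasCompactSupport.zero, Lp.coeFn_zero _ _ _, fun j => ?_⟩
    refine (Lp.coeFn_zero _ _ _).trans (ae_of_all _ fun x => ?_)
    simp [partialDerivC]
  add_mem' := by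
    rintro z w ⟨φ, h1, h2, h3, h4⟩ ⟨χ, k1, k2, k3, k4⟩
    refine ⟨φ + χ, h1.add k1, h2.add k2, ?_, fun j => ?_⟩
    · exact (Lp.coeFn_add _ _).trans (h3.add k3)
    · refine (Lp.coeFn_add _ _).trans (((h4 j).add (k4 j)).trans (ae_of_all _ fun x => ?_))
      exact (partialDerivC_add (h1.differentiable (by simp)) (k1.differentiable (by simp)) j x).symm
  smul_mem' := by
    rintro c z ⟨φ, h1, h2, h3, h4⟩
    refine ⟨c • φ, contDiff_const.smul h1, h2.smul_left, ?_, fun j => ?_⟩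
    · exact (Lp.coeFn_smul _ _).trans (h3.const_smul c)
    · refine (Lp.coeFn_smul _ _).trans (((h4 j).const_smul c).trans (ae_of_all _ fun x => ?_))
      exact (partialDerivC_smul (h1.differentiable (by simp)) c j x).symm

lemma memLp_of_contDiff {φ : Plane → ℂ} (h1 : ContDiff ℝ ∞ φ) (h2 : HasCompactSupport φ) :
    MemLp φ 2 := h1.continuous.memLp_of_hasCompactSupport h2

lemma memLp_partialDerivC {φ : Plane → ℂ} (h1 : ContDiff ℝ ∞ φ) (h2 : HasCompactSupport φ)
    (j : Fin 2) : MemLp (partialDerivC φ j) 2 :=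
  (continuous_partialDerivC h1 j).memLp_of_hasCompactSupport (hasCompactSupport_partialDerivC h2 j)

lemma contDiff_ofReal {φ : Plane → ℝ} (h : ContDiff ℝ ∞ φ) :
    ContDiff ℝ ∞ fun x => (φ x : ℂ) := Complex.ofRealCLM.contDiff.comp h

lemma hasCompactSupport_ofReal {φ : Plane → ℝ} (h : HasCompactSupport φ) :
    HasCompactSupport fun x => (φ x : ℂ) := h.comp_left Complex.ofReal_zero

lemma partialDerivC_ofReal {φ : Plane → ℝ} (h : Differentiable ℝ φ) (j : Fin 2) (x : Plane) :
    partialDerivC (fun x => (φ x : ℂ)) j x = (partialDeriv j φ x : ℂ) := by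
  have := (Complex.ofRealCLM.hasFDerivAt (x := φ x)).comp x (h x).hasFDerivAt
  rw [partialDerivC, show (fun x => (φ x : ℂ)) = Complex.ofRealCLM ∘ φ from rfl, this.fderiv]
  rfl

lemma hasWeakGradient_partialDerivC {ψ : Plane → ℂ} (h1 : ContDiff ℝ ∞ ψ) :
    HasWeakGradient ψ (partialDerivC ψ) := by
  intro j φ hφ hφs
  have hdφ : Differentiable ℝ φ := hφ.differentiable (by simp)
  have hd : Differentiable ℝ ψ := h1.differentiable (by simp)
  have hc : Continuous (partialDeriv j φ) :=
    (hφ.continuous_fderiv (by simp)).clm_apply continuous_const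
  have i1 : Integrable fun x => partialDeriv j φ x • ψ x :=
    (hc.smul h1.continuous).integrable_of_hasCompactSupport (hφs.fderiv_apply ℝ _).smul_right
  have i2 : Integrable fun x => φ x • partialDerivC ψ j x :=
    (hφ.continuous.smul (continuous_partialDerivC h1 j)).integrable_of_hasCompactSupport
      hφs.smul_right
  have i3 : Integrable fun x => φ x • ψ x :=
    (hφ.continuous.smul h1.continuous).integrable_of_hasCompactSupport hφs.smul_right
  have := integral_smul_fderiv_eq_neg_fderiv_smul_of_integrable (μ := (volume : Measure Plane))
    (f := φ) (g := ψ) (v := EuclideanSpace.single j (1 : ℝ)) i1 i2 i3 (fun x _ => hdφ x)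
    (fun x _ => hd x)
  simp only [partialDerivC]
  rw [this, neg_neg]
  rfl

/-- The vector fields dual to the weak gradient condition. -/
noncomputable def weakTriple (j : Fin 2) {φ : Plane → ℝ} (hφ : ContDiff ℝ ∞ φ)
    (hφs : HasCompactSupport φ) : SobolevAmbient :=
  sobolevTriple (u := partialDerivC (fun x => (φ x : ℂ)) j)
    (g := fun i => if i = j then fun x => (φ x : ℂ) else 0)
    (memLp_partialDerivC (contDiff_ofReal hφ) (hasCompactSupport_ofReal hφs) j)
    fun i => by
      split_ifs
      · exact memLp_of_contDiff (contDiff_ofReal hφ) (hasCompactSupport_ofReal hφs)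
      · exact MemLp.zero

lemma inner_weakTriple (j : Fin 2) {φ : Plane → ℝ} (hφ : ContDiff ℝ ∞ φ)
    (hφs : HasCompactSupport φ) (z : SobolevAmbient) :
    inner ℂ (weakTriple j hφ hφs) z =
      ∫ x, (partialDeriv j φ x • z 0 x + φ x • z j.succ x) := by
  rw [weakTriple, inner_sobolevTriple]
  refine integral_congr_ae (ae_of_all _ fun x => ?_)
  simp only [partialDerivC_ofReal (hφ.differentiable (by simp)), ite_apply, Pi.zero_apply,
    apply_ite (starRingEnd ℂ), map_zero, mul_ite, mul_zero, Finset.sum_ite_eq', Finset.mem_univ,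
    if_true, Complex.conj_ofReal, Complex.real_smul]
  ring

/-- The span of the vector fields dual to the weak gradient condition. -/
noncomputable def weakSpan : Submodule ℂ SobolevAmbient :=
  Submodule.span ℂ {z | ∃ (j : Fin 2) (φ : Plane → ℝ) (hφ : ContDiff ℝ ∞ φ)
    (hφs : HasCompactSupport φ), z = weakTriple j hφ hφs}

/-- This orthogonal complement is the graph of the weak gradient, that is, H¹ as a subspace of L²
triples; in this form its closedness is automatic. -/
lemma mem_weakSpan_orthogonal {z : SobolevAmbient} : z ∈ weakSpanᗮ ↔
    ∀ (j : Fin 2) (φ : Plane → ℝ), ContDiff ℝ ∞ φ → HasCompactSupport φ →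
      ∫ x, (partialDeriv j φ x • z 0 x + φ x • z j.succ x) = 0 := by
  rw [Submodule.mem_orthogonal]
  constructor
  · intro h j φ hφ hφs
    rw [← inner_weakTriple j hφ hφs]
    exact h _ (Submodule.subset_span ⟨j, φ, hφ, hφs, rfl⟩)
  · intro h w hw
    induction hw using Submodule.span_induction with
    | mem w hw =>
      obtain ⟨j, φ, hφ, hφs, rfl⟩ := hw
      rw [inner_weakTriple, h j φ hφ hφs]
    | zero => exact inner_zero_left _
    | add a c _ _ ha hc => rw [inner_add_left, ha, hc, add_zero]
    | smul r a _ ha => rw [inner_smul_left, ha, mul_zero]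

lemma mem_weakSpan_orthogonal_of_hasWeakGradient {u : Plane → ℂ} {g : Fin 2 → Plane → ℂ}
    (hu : MemLp u 2) (hg : ∀ j, MemLp (g j) 2) (h : HasWeakGradient u g) {z : SobolevAmbient}
    (h0 : z 0 =ᵐ[volume] u) (hj : ∀ j : Fin 2, z j.succ =ᵐ[volume] g j) : z ∈ weakSpanᗮ := by
  rw [mem_weakSpan_orthogonal]
  intro j φ hφ hφs
  have hc : Continuous (partialDeriv j φ) :=
    (hφ.continuous_fderiv (by simp)).clm_apply continuous_const
  have i1 : Integrable fun x => partialDeriv j φ x • u x :=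
    integrable_ofReal_smul (hc.memLp_of_hasCompactSupport (hφs.fderiv_apply ℝ _)) hu
  have i2 : Integrable fun x => φ x • g j x :=
    integrable_ofReal_smul (hφ.continuous.memLp_of_hasCompactSupport hφs) (hg j)
  have h1 : ∫ x, (partialDeriv j φ x • z 0 x + φ x • z j.succ x) =
      ∫ x, (partialDeriv j φ x • u x + φ x • g j x) := by
    refine integral_congr_ae ?_
    filter_upwards [h0, hj j] with x hx hx'
    rw [hx, hx']
  rw [h1, integral_add i1 i2, h j φ hφ hφs, neg_add_cancel]

lemma mem_smoothTriples_sobolevTriple {φ : Plane → ℂ} (h1 : ContDiff ℝ ∞ φ)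
    (h2 : HasCompactSupport φ) : sobolevTriple (memLp_of_contDiff h1 h2)
      (memLp_partialDerivC h1 h2) ∈ smoothTriples :=
  ⟨φ, h1, h2, (memLp_of_contDiff h1 h2).coeFn_toLp,
    fun j => (memLp_partialDerivC h1 h2 j).coeFn_toLp⟩

lemma smoothTriples_le : smoothTriples ≤ weakSpanᗮ := by
  rintro z ⟨φ, h1, h2, h3, h4⟩
  exact mem_weakSpan_orthogonal_of_hasWeakGradient (memLp_of_contDiff h1 h2)
    (memLp_partialDerivC h1 h2) (hasWeakGradient_partialDerivC h1) h3 h4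

/-- A triple `(a, ∇a)` orthogonal to all `(φ, ∇φ)` satisfies `a - Δa = 0` weakly, so it vanishes by
`ae_eq_zero_of_weak_eq`. -/
lemma eq_zero_of_mem_orthogonal {z : SobolevAmbient} (h1 : z ∈ smoothTriplesᗮ)
    (h2 : z ∈ weakSpanᗮ) : z = 0 := by
  have key := ae_eq_zero_of_weak_eq (Lp.memLp (z 0)) (fun j : Fin 2 => Lp.memLp (z j.succ))
    (fun φ hφ hφs => ?_) (mem_weakSpan_orthogonal.1 h2)
  · ext i : 1
    refine Lp.ext (EventuallyEq.trans ?_ (Lp.coeFn_zero _ _ _).symm)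
    refine Fin.cases key.1 key.2 i
  · have h3 := (Submodule.mem_orthogonal _ _).1 h1 _
      (mem_smoothTriples_sobolevTriple (contDiff_ofReal hφ) (hasCompactSupport_ofReal hφs))
    rw [inner_sobolevTriple] at h3
    rw [← h3]
    refine integral_congr_ae (ae_of_all _ fun x => ?_)
    simp only [partialDerivC_ofReal (hφ.differentiable (by simp)), Complex.conj_ofReal,
      Complex.real_smul, mul_comm]

/-- Smooth compactly supported functions are dense in `H¹(ℝ²)`. -/
theorem exists_contDiff_tendsto {u : Plane → ℂ} {g : Fin 2 → Plane → ℂ} (hu : MemLp u 2)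
    (hg : HasL2WeakGradient u g) : ∃ φ : ℕ → Plane → ℂ,
      (∀ n, ContDiff ℝ ∞ (φ n)) ∧ (∀ n, HasCompactSupport (φ n)) ∧
      Tendsto (fun n => eLpNorm (φ n - u) 2 volume) atTop (𝓝 0) ∧
      ∀ j, Tendsto (fun n => eLpNorm (partialDerivC (φ n) j - g j) 2 volume) atTop (𝓝 0) := by
  set x := sobolevTriple hu hg.1 with hx
  set K := smoothTriples.topologicalClosure with hK
  have hKc : IsClosed (K : Set SobolevAmbient) := Submodule.isClosed_topologicalClosure _
  have : CompleteSpace K := hKc.completeSpace_coe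
  have hxV : x ∈ weakSpanᗮ := mem_weakSpan_orthogonal_of_hasWeakGradient hu hg.1 hg.2
    hu.coeFn_toLp fun j => (hg.1 j).coeFn_toLp
  have hKV : K ≤ weakSpanᗮ :=
    Submodule.topologicalClosure_minimal _ smoothTriples_le (Submodule.isClosed_orthogonal _)
  have hxK : x ∈ K := by
    -- The residual of the projection onto the closure of the smooth triples is orthogonal to them
    -- and still lies in the graph of the weak gradient, hence is zero.
    have hy1 : x - K.starProjection x ∈ Kᗮ := Submodule.sub_starProjection_mem_orthogonal x
    have hy2 : x - K.starProjection x ∈ weakSpanᗮ :=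
      Submodule.sub_mem _ hxV (hKV (Submodule.starProjection_apply_mem _ _))
    have h0 := eq_zero_of_mem_orthogonal
      (Submodule.orthogonal_le (Submodule.le_topologicalClosure _) hy1) hy2
    rw [sub_eq_zero.1 h0]
    exact Submodule.starProjection_apply_mem _ _
  obtain ⟨w, hw, hwx⟩ := mem_closure_iff_seq_limit.1 hxK
  choose φ h1 h2 h3 h4 using hw
  have hcomp : ∀ i, Tendsto (fun n => w n i) atTop (𝓝 (x i)) := fun i =>
    ((PiLp.continuous_apply 2 _ i).tendsto x).comp hwx
  refine ⟨φ, h1, h2, ?_, fun j => ?_⟩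
  · have := (Lp.tendsto_Lp_iff_tendsto_eLpNorm _ _ hu).1 (hcomp 0)
    refine this.congr fun n => eLpNorm_congr_ae ?_
    exact (h3 n).sub (EventuallyEq.refl _ _)
  · have := (Lp.tendsto_Lp_iff_tendsto_eLpNorm _ _ (hg.1 j)).1 (hcomp j.succ)
    refine this.congr fun n => eLpNorm_congr_ae ?_
    exact (h4 n j).sub (EventuallyEq.refl _ _)

/-! ### Passage to the limit in the quadratic form -/

lemma eLpNorm_two_eq {α E : Type*} [MeasurableSpace α] [NormedAddCommGroup E] {μ : Measure α}
    {f : α → E} (hf : MemLp f 2 μ) :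
    eLpNorm f 2 μ = ENNReal.ofReal (√(∫ x, ‖f x‖ ^ 2 ∂μ)) := by
  rw [hf.eLpNorm_eq_integral_rpow_norm (by norm_num) (by norm_num), Real.sqrt_eq_rpow]
  norm_num

lemma toReal_eLpNorm_two_sq {α E : Type*} [MeasurableSpace α] [NormedAddCommGroup E]
    {μ : Measure α} {f : α → E} (hf : MemLp f 2 μ) :
    (eLpNorm f 2 μ).toReal ^ 2 = ∫ x, ‖f x‖ ^ 2 ∂μ := by
  have h : 0 ≤ ∫ x, ‖f x‖ ^ 2 ∂μ := integral_nonneg fun x => by positivity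
  rw [eLpNorm_two_eq hf, ENNReal.toReal_ofReal (Real.sqrt_nonneg _), Real.sq_sqrt h]

lemma tendsto_integral_norm_sq {α E : Type*} [MeasurableSpace α] [NormedAddCommGroup E]
    {μ : Measure α} {f : ℕ → α → E} {g : α → E} (hf : ∀ n, MemLp (f n) 2 μ) (hg : MemLp g 2 μ)
    (h : Tendsto (fun n => eLpNorm (f n - g) 2 μ) atTop (𝓝 0)) :
    Tendsto (fun n => ∫ x, ‖f n x‖ ^ 2 ∂μ) atTop (𝓝 (∫ x, ‖g x‖ ^ 2 ∂μ)) := by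
  have h1 := ((Lp.tendsto_Lp_iff_tendsto_eLpNorm'' f hf g hg).2 h).norm.pow 2
  simpa only [Lp.norm_toLp, toReal_eLpNorm_two_sq (hf _), toReal_eLpNorm_two_sq hg] using h1

/-- The measure with density `B`. -/
noncomputable def fieldMeasure (B : Plane → ℝ) : Measure Plane :=
  volume.withDensity fun x => ENNReal.ofReal (B x)

namespace IsRadialProfile

variable {b : ℝ → ℝ} {R : ℝ}

lemma integrable_fieldMeasure_iff (hb : IsRadialProfile b R) {f : Plane → ℝ} :
    Integrable f (fieldMeasure (radialField b)) ↔ Integrable fun x => radialField b x * f x := by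
  rw [fieldMeasure, integrable_withDensity_iff_integrable_smul'
    hb.measurable_radialField.ennreal_ofReal (by simp)]
  refine integrable_congr (ae_of_all _ fun x => ?_)
  simp only [smul_eq_mul]
  rw [radialField, ENNReal.toReal_ofReal (hb.nonneg _)]

lemma integral_fieldMeasure (hb : IsRadialProfile b R) (f : Plane → ℝ) :
    ∫ x, f x ∂(fieldMeasure (radialField b)) = ∫ x, radialField b x * f x := by
  rw [fieldMeasure, integral_withDensity_eq_integral_toReal_smul
    hb.measurable_radialField.ennreal_ofReal (by simp)]
  refine integral_congr_ae (ae_of_all _ fun x => ?_)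
  simp only [smul_eq_mul]
  rw [radialField, ENNReal.toReal_ofReal (hb.nonneg _)]

lemma memLp_fieldMeasure (hb : IsRadialProfile b R) {u : Plane → ℂ} (hu : ContDiff ℝ ∞ u)
    (hs : HasCompactSupport u) : MemLp u 2 (fieldMeasure (radialField b)) :=
  (memLp_two_iff_integrable_sq_norm hu.continuous.aestronglyMeasurable).2
    (hb.integrable_fieldMeasure_iff.2 (hb.integrable_field_of_bounded hu.continuous hs))

/-- The quadratic bound on the field term, rewritten with norms via `√(x² + y² + z²) ≤ x + y + z`,
so that it can be combined with the triangle inequality. -/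
lemma exists_eLpNorm_fieldMeasure_le (hb : IsRadialProfile b R) : ∃ C : ℝ≥0∞, C ≠ ⊤ ∧
    ∀ u : Plane → ℂ, ContDiff ℝ ∞ u → HasCompactSupport u →
      eLpNorm u 2 (fieldMeasure (radialField b)) ≤
        C * (eLpNorm u 2 volume + ∑ j, eLpNorm (partialDerivC u j) 2 volume) := by
  obtain ⟨C, hC0, hC⟩ := hb.exists_integral_field_le
  refine ⟨ENNReal.ofReal √C, by simp, fun u hu hs => ?_⟩
  have h1 := memLp_of_contDiff hu hs
  have h2 := memLp_partialDerivC hu hs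
  have h3 := hC u hu hs
  rw [integral_add ((memLp_two_iff_integrable_sq_norm h1.1).1 h1)
    (integrable_finsetSum _ fun j _ => (memLp_two_iff_integrable_sq_norm (h2 j).1).1 (h2 j)),
    integral_finsetSum _ fun j _ => (memLp_two_iff_integrable_sq_norm (h2 j).1).1 (h2 j)] at h3
  rw [eLpNorm_two_eq (hb.memLp_fieldMeasure hu hs), eLpNorm_two_eq h1]
  simp only [eLpNorm_two_eq (h2 _), hb.integral_fieldMeasure, Fin.sum_univ_two] at h3 ⊢
  rw [← ENNReal.ofReal_add (by positivity) (by positivity), ← ENNReal.ofReal_add (by positivity)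
    (by positivity), ← ENNReal.ofReal_mul (by positivity)]
  refine ENNReal.ofReal_le_ofReal (Real.sqrt_le_iff.2 ⟨by positivity, h3.trans ?_⟩)
  have hn : ∀ f : Plane → ℂ, 0 ≤ ∫ x, ‖f x‖ ^ 2 := fun f => integral_nonneg fun x => by positivity
  rw [mul_pow, Real.sq_sqrt hC0]
  refine mul_le_mul_of_nonneg_left ?_ hC0
  have s0 := Real.sq_sqrt (hn u)
  have s1 := Real.sq_sqrt (hn (partialDerivC u 0))
  have s2 := Real.sq_sqrt (hn (partialDerivC u 1))
  have p1 := mul_nonneg (Real.sqrt_nonneg (∫ x, ‖u x‖ ^ 2))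
    (Real.sqrt_nonneg (∫ x, ‖partialDerivC u 0 x‖ ^ 2))
  have p2 := mul_nonneg (Real.sqrt_nonneg (∫ x, ‖u x‖ ^ 2))
    (Real.sqrt_nonneg (∫ x, ‖partialDerivC u 1 x‖ ^ 2))
  have p3 := mul_nonneg (Real.sqrt_nonneg (∫ x, ‖partialDerivC u 0 x‖ ^ 2))
    (Real.sqrt_nonneg (∫ x, ‖partialDerivC u 1 x‖ ^ 2))
  nlinarith

/-- The field bound is available only for test functions, so it is applied to the differences `φ n -
φ m`. Fatou along a subsequence converging almost everywhere then lets `m → ∞` and identifies the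
limit as `u`. -/
lemma tendsto_eLpNorm_fieldMeasure (hb : IsRadialProfile b R) {u : Plane → ℂ}
    {g : Fin 2 → Plane → ℂ} {φ : ℕ → Plane → ℂ} (hu : MemLp u 2) (hg : ∀ j, MemLp (g j) 2)
    (h1 : ∀ n, ContDiff ℝ ∞ (φ n)) (h2 : ∀ n, HasCompactSupport (φ n))
    (h3 : Tendsto (fun n => eLpNorm (φ n - u) 2 volume) atTop (𝓝 0))
    (h4 : ∀ j, Tendsto (fun n => eLpNorm (partialDerivC (φ n) j - g j) 2 volume) atTop (𝓝 0)) :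
    Tendsto (fun n => eLpNorm (φ n - u) 2 (fieldMeasure (radialField b))) atTop (𝓝 0) := by
  obtain ⟨C, hCt, hC⟩ := hb.exists_eLpNorm_fieldMeasure_le
  have hac : fieldMeasure (radialField b) ≪ volume := withDensity_absolutelyContinuous _ _
  obtain ⟨s, hs, hsu⟩ := (tendstoInMeasure_of_tendsto_eLpNorm two_ne_zero
    (fun n => (h1 n).continuous.aestronglyMeasurable) hu.1 h3).exists_seq_tendsto_ae
  set e : ℕ → ℝ≥0∞ := fun n => eLpNorm (φ n - u) 2 volume +
    ∑ j, eLpNorm (partialDerivC (φ n) j - g j) 2 volume with he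
  have he0 : Tendsto e atTop (𝓝 0) := by
    simpa [he] using h3.add (tendsto_finsetSum Finset.univ fun j _ => h4 j)
  have hd : ∀ n m, eLpNorm (φ n - φ m) 2 (fieldMeasure (radialField b)) ≤ C * (e n + e m) := by
    intro n m
    refine (hC _ ((h1 n).sub (h1 m)) ((h2 n).sub (h2 m))).trans (mul_le_mul_right ?_ C)
    have t : ∀ a c d : Plane → ℂ, AEStronglyMeasurable a volume → AEStronglyMeasurable c volume →
        AEStronglyMeasurable d volume →
        eLpNorm (a - c) 2 volume ≤ eLpNorm (a - d) 2 volume + eLpNorm (c - d) 2 volume := by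
      intro a c d ha hc hd
      have := eLpNorm_sub_le (ha.sub hd) (hc.sub hd) (p := 2) (by norm_num)
      rwa [sub_sub_sub_cancel_right] at this
    have hp : ∀ j, partialDerivC (φ n - φ m) j = partialDerivC (φ n) j - partialDerivC (φ m) j := by
      intro j
      funext x
      simp only [partialDerivC, Pi.sub_apply]
      rw [fderiv_sub ((h1 n).differentiable (by simp) x) ((h1 m).differentiable (by simp) x)]
      rfl
    have q0 := t (φ n) (φ m) u (h1 n).continuous.aestronglyMeasurable
      (h1 m).continuous.aestronglyMeasurable hu.1
    have q : ∀ j, _ := fun j => t (partialDerivC (φ n) j) (partialDerivC (φ m) j) (g j)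
      (continuous_partialDerivC (h1 n) j).aestronglyMeasurable
      (continuous_partialDerivC (h1 m) j).aestronglyMeasurable (hg j).1
    calc _ ≤ _ := add_le_add q0 (Finset.sum_le_sum fun j _ => (hp j).symm ▸ q j)
      _ = e n + e m := by
        rw [he, Finset.sum_add_distrib]
        ring
  have hle : ∀ n, eLpNorm (φ n - u) 2 (fieldMeasure (radialField b)) ≤ C * e n := by
    intro n
    have hlim := Lp.eLpNorm_lim_le_liminf_eLpNorm (p := 2) (μ := fieldMeasure (radialField b))
      (f := fun k => φ n - φ (s k))
      (fun k => ((h1 n).continuous.sub (h1 (s k)).continuous).aestronglyMeasurable) (φ n - u)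
      (hac.ae_le (hsu.mono fun x hx => tendsto_const_nhds.sub hx))
    refine hlim.trans ?_
    have ht : Tendsto (fun k => C * (e n + e (s k))) atTop (𝓝 (C * (e n + 0))) :=
      ENNReal.Tendsto.const_mul (tendsto_const_nhds.add (he0.comp hs.tendsto_atTop)) (Or.inr hCt)
    calc _ ≤ liminf (fun k => C * (e n + e (s k))) atTop :=
          liminf_le_liminf (Eventually.of_forall fun k => hd n (s k))
      _ = C * e n := by rw [ht.liminf_eq, add_zero]
  refine tendsto_of_tendsto_of_tendsto_of_le_of_le tendsto_const_nhds ?_ (fun _ => zero_le) hle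
  simpa using ENNReal.Tendsto.const_mul he0 (Or.inr hCt)

lemma memLp_kinetic (hb : IsRadialProfile b R) {u v : Plane → ℂ} (hu : MemLp u 2)
    (hv : MemLp v 2) (j : Fin 2) : MemLp
      (fun x => Complex.I * v x + (vectorPotential (radialField b) x j : ℂ) * u x) 2 := by
  obtain ⟨C, -, hC⟩ := hb.exists_abs_vectorPotential_le
  refine (hv.const_mul Complex.I).add (hu.of_le_mul (c := C) ?_ (ae_of_all _ fun x => ?_))
  · exact (Complex.measurable_ofReal.comp
      (hb.measurable_vectorPotential j)).aestronglyMeasurable.mul hu.1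
  · rw [norm_mul, Complex.norm_real]
    exact mul_le_mul_of_nonneg_right (hC x j) (norm_nonneg _)

lemma tendsto_integral_kineticDensity (hb : IsRadialProfile b R) {u : Plane → ℂ}
    {g : Fin 2 → Plane → ℂ} {φ : ℕ → Plane → ℂ} {γ : ℕ → Fin 2 → Plane → ℂ} (hu : MemLp u 2)
    (hg : ∀ j, MemLp (g j) 2) (h1 : ∀ n, MemLp (φ n) 2) (h2 : ∀ n j, MemLp (γ n j) 2)
    (h3 : Tendsto (fun n => eLpNorm (φ n - u) 2 volume) atTop (𝓝 0))
    (h4 : ∀ j, Tendsto (fun n => eLpNorm (γ n j - g j) 2 volume) atTop (𝓝 0)) :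
    Tendsto (fun n => ∫ x, kineticDensity (radialField b) (φ n) (γ n) x) atTop
      (𝓝 (∫ x, kineticDensity (radialField b) u g x)) := by
  obtain ⟨C, hC0, hC⟩ := hb.exists_abs_vectorPotential_le
  have hi : ∀ {v : Plane → ℂ} {f : Fin 2 → Plane → ℂ}, MemLp v 2 → (∀ j, MemLp (f j) 2) →
      ∫ x, kineticDensity (radialField b) v f x = ∑ j, ∫ x,
        ‖Complex.I * f j x + (vectorPotential (radialField b) x j : ℂ) * v x‖ ^ 2 := by
    intro v f hv hf
    exact integral_finsetSum _ fun j _ => (memLp_two_iff_integrable_sq_norm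
      (hb.memLp_kinetic hv (hf j) j).1).1 (hb.memLp_kinetic hv (hf j) j)
  rw [hi hu hg]
  simp only [hi (h1 _) (h2 _)]
  refine tendsto_finsetSum _ fun j _ => tendsto_integral_norm_sq
    (fun n => hb.memLp_kinetic (h1 n) (h2 n j) j) (hb.memLp_kinetic hu (hg j) j) ?_
  refine tendsto_of_tendsto_of_tendsto_of_le_of_le tendsto_const_nhds (h := fun n =>
    eLpNorm (γ n j - g j) 2 volume + ENNReal.ofReal C * eLpNorm (φ n - u) 2 volume) ?_
    (fun _ => zero_le) fun n => ?_
  · simpa using (h4 j).add (ENNReal.Tendsto.const_mul h3 (Or.inr ENNReal.ofReal_ne_top))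
  · have e1 : eLpNorm (fun x => Complex.I * (γ n j - g j) x) 2 volume ≤
        eLpNorm (γ n j - g j) 2 volume :=
      eLpNorm_mono fun x => by simp
    have e2 : eLpNorm (fun x => (vectorPotential (radialField b) x j : ℂ) * (φ n - u) x) 2 volume ≤
        ENNReal.ofReal C * eLpNorm (φ n - u) 2 volume := by
      refine eLpNorm_le_mul_eLpNorm_of_ae_le_mul (ae_of_all _ fun x => ?_) 2
      rw [norm_mul, Complex.norm_real]
      exact mul_le_mul_of_nonneg_right (hC x j) (norm_nonneg _)
    refine le_trans (le_of_eq ?_) ((eLpNorm_add_le (p := 2)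
      (((h2 n j).sub (hg j)).const_mul Complex.I).1 ?_ (by norm_num)).trans (add_le_add e1 e2))
    · congr 1
      funext x
      simp only [Pi.sub_apply, Pi.add_apply]
      ring
    · exact (Complex.measurable_ofReal.comp
        (hb.measurable_vectorPotential j)).aestronglyMeasurable.mul ((h1 n).sub hu).1

lemma tendsto_integral_weight (hR : 0 < R) {u : Plane → ℂ} {φ : ℕ → Plane → ℂ} (hu : MemLp u 2)
    (h1 : ∀ n, MemLp (φ n) 2)
    (h3 : Tendsto (fun n => eLpNorm (φ n - u) 2 volume) atTop (𝓝 0)) :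
    Tendsto (fun n => ∫ x, ‖φ n x‖ ^ 2 / (R ^ 2 + ‖x‖ ^ 2)) atTop
      (𝓝 (∫ x, ‖u x‖ ^ 2 / (R ^ 2 + ‖x‖ ^ 2))) := by
  -- The square root of the weight, bounded by `R⁻¹`, turns the weighted integral into an L² norm.
  set w : Plane → ℝ := fun x => (√(R ^ 2 + ‖x‖ ^ 2))⁻¹ with hw
  have hpos : ∀ x : Plane, 0 < √(R ^ 2 + ‖x‖ ^ 2) := fun x => by positivity
  have hwc : Continuous w := Continuous.inv₀ (by fun_prop) fun x => (hpos x).ne'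
  have hle : ∀ (f : Plane → ℂ) (x : Plane), ‖w x • f x‖ ≤ R⁻¹ * ‖f x‖ := by
    intro f x
    rw [norm_smul, Real.norm_eq_abs, abs_of_nonneg (inv_nonneg.2 (hpos x).le)]
    refine mul_le_mul_of_nonneg_right (inv_anti₀ hR ?_) (norm_nonneg _)
    exact Real.le_sqrt_of_sq_le (by nlinarith [sq_nonneg ‖x‖])
  have hm : ∀ {f : Plane → ℂ}, MemLp f 2 → MemLp (fun x => w x • f x) 2 := fun hf =>
    hf.of_le_mul (hwc.aestronglyMeasurable.smul hf.1) (ae_of_all _ (hle _))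
  have heq : ∀ (f : Plane → ℂ) (x : Plane), ‖f x‖ ^ 2 / (R ^ 2 + ‖x‖ ^ 2) = ‖w x • f x‖ ^ 2 := by
    intro f x
    rw [norm_smul, mul_pow, Real.norm_eq_abs, sq_abs, inv_pow, Real.sq_sqrt (by positivity)]
    ring
  simp only [heq]
  refine tendsto_integral_norm_sq (fun n => hm (h1 n)) (hm hu) ?_
  refine tendsto_of_tendsto_of_tendsto_of_le_of_le tendsto_const_nhds (h := fun n =>
    ENNReal.ofReal R⁻¹ * eLpNorm (φ n - u) 2 volume) ?_ (fun _ => zero_le) fun n => ?_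
  · simpa using ENNReal.Tendsto.const_mul h3 (Or.inr ENNReal.ofReal_ne_top)
  · refine eLpNorm_le_mul_eLpNorm_of_ae_le_mul (ae_of_all _ fun x => ?_) 2
    simp only [Pi.sub_apply, ← smul_sub]
    exact hle (φ n - u) x

/-- The Hardy inequality for the form `Q₊` on `H¹(ℝ²)`. -/
theorem hardy_of_hasL2WeakGradient (hb : IsRadialProfile b R) {u : Plane → ℂ}
    {g : Fin 2 → Plane → ℂ} (hu : MemLp u 2) (hg : HasL2WeakGradient u g) :
    Integrable (fun x => kineticDensity (radialField b) u g x + radialField b x * ‖u x‖ ^ 2) ∧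
    Real.exp (2 * (radialPotential b R - radialPotential b 0)) *
        distInt (∫ t, b t * t) ^ 2 * ∫ x, ‖u x‖ ^ 2 / (R ^ 2 + ‖x‖ ^ 2) ≤
      ∫ x, (kineticDensity (radialField b) u g x + radialField b x * ‖u x‖ ^ 2) := by
  obtain ⟨φ, h1, h2, h3, h4⟩ := exists_contDiff_tendsto hu hg
  have hac : fieldMeasure (radialField b) ≪ volume := withDensity_absolutelyContinuous _ _
  have hφ := fun n => memLp_of_contDiff (h1 n) (h2 n)
  have hν := hb.tendsto_eLpNorm_fieldMeasure hu hg.1 h1 h2 h3 h4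
  have hφν := fun n => hb.memLp_fieldMeasure (h1 n) (h2 n)
  -- Convergence makes the norm of `φ n - u` finite for some `n`, and `φ n` itself is square
  -- integrable against B.
  have huν : MemLp u 2 (fieldMeasure (radialField b)) := by
    obtain ⟨n, hn⟩ := (hν.eventually_lt_const ENNReal.zero_lt_top).exists
    have h5 : MemLp (φ n - u) 2 (fieldMeasure (radialField b)) :=
      ⟨(h1 n).continuous.aestronglyMeasurable.sub (hu.1.mono_ac hac), hn⟩
    simpa using (hφν n).sub h5
  have hBu : Integrable fun x => radialField b x * ‖u x‖ ^ 2 :=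
    hb.integrable_fieldMeasure_iff.1 ((memLp_two_iff_integrable_sq_norm huν.1).1 huν)
  have hK := hb.integrable_kineticDensity hu hg.1
  refine ⟨hK.add hBu, ?_⟩
  rw [integral_add hK hBu]
  have hB := tendsto_integral_norm_sq hφν huν hν
  simp only [hb.integral_fieldMeasure] at hB
  exact le_of_tendsto_of_tendsto' ((tendsto_integral_weight hb.pos hu hφ h3).const_mul _)
    ((hb.tendsto_integral_kineticDensity hu hg.1 hφ
      (fun n => memLp_partialDerivC (h1 n) (h2 n)) h3 h4).add hB)
    fun n => hb.hardy_of_contDiff (h1 n) (h2 n)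

end IsRadialProfile

/-! ### Reduction to a Borel profile and conclusion -/

/-- The measure `r dr` on `(0, R]` is finite, so L^p embeds in L². The profile is the absolute value
of a Borel representative, cut off to `(0, R)`. -/
lemma exists_isRadialProfile {b : ℝ → ℝ} {p : ℝ≥0∞} {R : ℝ} (hp : 2 ≤ p) (hR : 0 < R)
    (hb : MemLpLocRadial b p) (hb_nonneg : ∀ᵐ r : ℝ, 0 < r → 0 ≤ b r)
    (hb_supp : ∀ᵐ r : ℝ, R ≤ r → b r = 0) :
    ∃ b', IsRadialProfile b' R ∧ ∀ᵐ r : ℝ, 0 < r → b r = b' r := by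
  set ν := (volume.restrict (Ioc 0 R)).withDensity fun r : ℝ => ENNReal.ofReal r with hν
  have hfin : IsFiniteMeasure ν := by
    refine isFiniteMeasure_withDensity_ofReal ?_
    exact ((continuous_id.integrableOn_Icc (a := 0) (b := R)).mono_set Ioc_subset_Icc_self).2
  have h2 : MemLp b 2 ν := (hb R hR).mono_exponent hp
  -- The density `r` is positive on `(0, R]`, so equality almost everywhere for `r dr` is equality
  -- almost everywhere for Lebesgue measure.
  have hac : volume.restrict (Ioc 0 R) ≪ ν := by
    refine withDensity_absolutelyContinuous' ENNReal.measurable_ofReal.aemeasurable ?_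
    filter_upwards [ae_restrict_mem measurableSet_Ioc] with r hr
    simpa using hr.1
  set f := h2.1.mk b with hf
  have hfm : Measurable f := h2.1.stronglyMeasurable_mk.measurable
  have hbf : ∀ᵐ r : ℝ, r ∈ Ioc 0 R → b r = f r :=
    (ae_restrict_iff' measurableSet_Ioc).1 (hac.ae_le h2.1.ae_eq_mk)
  refine ⟨(Ioo 0 R).indicator fun r => |f r|, ⟨hR, hfm.abs.indicator measurableSet_Ioo,
    fun r => indicator_nonneg (fun _ _ => abs_nonneg _) r,
    fun r hr => indicator_of_notMem hr _, ?_⟩, ?_⟩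
  · have h3 : Integrable (fun r => f r ^ 2) ν := by
      simpa using (memLp_two_iff_integrable_sq_norm (h2.ae_eq h2.1.ae_eq_mk).1).1
        (h2.ae_eq h2.1.ae_eq_mk)
    rw [hν, integrable_withDensity_iff_integrable_smul' ENNReal.measurable_ofReal (by simp)] at h3
    have h4 := (integrable_indicator_iff measurableSet_Ioo).2
      (IntegrableOn.mono_set h3 Ioo_subset_Ioc_self)
    refine h4.congr (ae_of_all _ fun r => ?_)
    by_cases hr : r ∈ Ioo 0 R
    · simp only [indicator_of_mem hr, smul_eq_mul, sq_abs, ENNReal.toReal_ofReal hr.1.le]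
      ring
    · simp [indicator_of_notMem hr]
  · filter_upwards [hbf, hb_nonneg, hb_supp] with r h1 h2 h3 h0
    rcases lt_or_ge r R with hr | hr
    · rw [indicator_of_mem (show r ∈ Ioo 0 R from ⟨h0, hr⟩), ← h1 ⟨h0, hr.le⟩,
        abs_of_nonneg (h2 h0)]
    · rw [indicator_of_notMem (fun h => absurd h.2 (not_lt.2 hr)), h3 hr]

/-- Equality holds at every point, not merely almost everywhere, as differentiability and the
infimum and supremum in β₊ require. -/
lemma scalarPotential_congr {B B' : Plane → ℝ} (h : B =ᵐ[volume] B') :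
    scalarPotential B = scalarPotential B' := by
  funext x
  rw [scalarPotential, scalarPotential]
  congr 1
  exact integral_congr_ae (h.mono fun y hy => by simp only [hy])

lemma flux_congr {B B' : Plane → ℝ} (h : B =ᵐ[volume] B') : flux B = flux B' := by
  rw [flux, flux, integral_congr_ae h]

lemma betaPlus_congr {B B' : Plane → ℝ} (h : B =ᵐ[volume] B') (ρ : ℝ) :
    betaPlus B ρ = betaPlus B' ρ := by
  simp only [betaPlus, kPlus, capKPlus, scalarPotential_congr h, flux_congr h]

lemma pauliDensity_congr {B B' : Plane → ℝ} (h : B =ᵐ[volume] B') (u : Plane → ℂ) :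
    pauliDensity B u =ᵐ[volume] pauliDensity B' u := by
  filter_upwards [h] with x hx
  simp only [pauliDensity, vectorPotential, scalarPotential_congr h, hx]

lemma logMoment_congr {b b' : ℝ → ℝ} {R : ℝ} (hR : 0 ≤ R)
    (h : ∀ᵐ r : ℝ, 0 < r → b r = b' r) : logMoment b R = logMoment b' R := by
  refine intervalIntegral.integral_congr_ae (h.mono fun r hr hr' => ?_)
  rw [uIoc_of_le hR] at hr'
  rw [hr hr'.1]

lemma hasL2WeakGradient_weakGradient {u : Plane → ℂ} (hu : ∃ g, HasL2WeakGradient u g) :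
    HasL2WeakGradient u (weakGradient u) := by
  rw [weakGradient, dif_pos hu]
  exact Classical.choose_spec hu

lemma IsRadialProfile.exp_radialPotential_sub {b : ℝ → ℝ} {R : ℝ} (hb : IsRadialProfile b R) :
    Real.exp (2 * (radialPotential b R - radialPotential b 0)) =
      Real.exp (2 * logMoment b R) / R ^ (2 * flux (radialField b)) := by
  rw [hb.radialPotential_zero, hb.radialPotential_of_ge le_rfl, hb.flux_radialField,
    Real.rpow_def_of_pos hb.pos, ← Real.exp_sub]
  congr 1
  ring

end PauliHardy

theorem proposition2p8 (b : ℝ → ℝ) (p : ℝ≥0∞) (R : ℝ) (hp : 2 < p) (hR : 0 < R)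
    (hb : PauliHardy.MemLpLocRadial b p)
    (hb_nonneg : ∀ᵐ r : ℝ, 0 < r → 0 ≤ b r)
    (hb_supp : ∀ᵐ r : ℝ, R ≤ r → b r = 0)
    (hflux : 0 < ∫ x, PauliHardy.radialField b x) :
    Differentiable ℝ (PauliHardy.scalarPotential (PauliHardy.radialField b)) ∧
    PauliHardy.betaPlus (PauliHardy.radialField b) R =
      Real.exp (2 * PauliHardy.logMoment b R) /
        R ^ (2 * PauliHardy.flux (PauliHardy.radialField b)) ∧
    ∀ u : PauliHardy.Plane → ℂ, PauliHardy.MemH1 u →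
      Integrable (PauliHardy.pauliDensity (PauliHardy.radialField b) u) ∧
      PauliHardy.distInt (PauliHardy.flux (PauliHardy.radialField b)) ^ 2 *
          (Real.exp (2 * PauliHardy.logMoment b R) /
            R ^ (2 * PauliHardy.flux (PauliHardy.radialField b))) *
          (∫ x, ‖u x‖ ^ 2 / (R ^ 2 + ‖x‖ ^ 2)) ≤
        PauliHardy.pauliForm (PauliHardy.radialField b) u := by
  obtain ⟨b', hb', hbb'⟩ := PauliHardy.exists_isRadialProfile hp.le hR hb hb_nonneg hb_supp
  have hB : PauliHardy.radialField b =ᵐ[volume] PauliHardy.radialField b' :=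
    PauliHardy.ae_norm_of_ae_pos hbb'
  rw [PauliHardy.scalarPotential_congr hB, PauliHardy.betaPlus_congr hB,
    PauliHardy.flux_congr hB, PauliHardy.logMoment_congr hR.le hbb']
  refine ⟨hb'.differentiable_scalarPotential, hb'.betaPlus_radialField, fun u hu => ?_⟩
  have hd := PauliHardy.pauliDensity_congr hB u
  obtain ⟨h1, h2⟩ := hb'.hardy_of_hasL2WeakGradient hu.1
    (PauliHardy.hasL2WeakGradient_weakGradient hu.2)
  rw [hb'.exp_radialPotential_sub, ← hb'.flux_radialField] at h2
  refine ⟨h1.congr hd.symm, ?_⟩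
  rw [PauliHardy.pauliForm, integral_congr_ae hd, mul_comm (_ ^ 2)]
  exact h2
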